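/- **Setting.** Let $n\ge 1$ and let $\dot x=f(x)+g(x)u$, $y=h(x)$ be a single-input single-output system on $\mathbb R^n$ with $f,g,h$ smooth, such that $h$ has relative degree $n$ with positive gain: $L_gL_f^ih(x)=0$ for $0\le i\le n-2$ and $L_gL_f^{n-1}h(x)>0$ for all $x\in\mathbb R^n$. Assume that $\Psi(x)=(h(x),L_fh(x),\dots,L_f^{n-1}h(x))$ is a diffeomorphism of $\mathbb R^n$ onto itself with $\Psi(0)=0$. Put $z=\Psi(x)$, $\alpha=L_f^nh\circ\Psi^{-1}$, $\beta=L_gL_f^{n-1}h\circ\Psi^{-1}$, $u_0=-\beta(0)^{-1}\alpha(0)$, so that $\dot z_i=z_{i+1}$ for $i<n$ and $\dot z_n=\alpha(z)+\beta(z)u$. For $T>0$ let $F^a_T(z,u)\in\mathbb R^n$ be the approximate discrete-time model $$F^a_{T,i}(z,u)=\sum_{j=i}^n z_j\frac{T^{j-i}}{(j-i)!}+(\alpha(z)+\beta(z)u)\frac{T^{n-i+1}}{(n-i+1)!},\qquad 1\le i\le n .$$ All norms are Euclidean. **Virtual input.** Let $V_z(z)=z^{T}P_zz$ with $P_z$ symmetric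 positive definite, let $\lambda>0$, let $v:\mathbb R^n\to\mathbb R$, and put $\bar u(z)=\beta(z)^{-1}(-\alpha(z)+v(z))$. Assume: 1. for every compact $D\subset\mathbb R^n$ there are $M,T_0>0$ such that for all $T\in(0,T_0]$ and $z\in D$ $$V_z(F^a_T(z,\bar u(z)))-V_z(z)\le-\lambda T\|z\|^2+MT^2\|(z,\bar u(z)-u_0)\|^2;$$ 2. for every compact $D\subset\mathbb R^n\times\mathbb R$ and every $M_1>0$ there are $M_2,T_0>0$ such that for all $T\in(0,T_0]$, $(z,u)\in D$ and $\delta\in\mathbb R^n$ with $\|\delta\|\le M_1T\|(z,u-u_0)\|$ $$|v(z+\delta)-v(z)|\le M_2T\|(z,u-u_0)\|.$$ **Closed loop.** For a sampling time $T>0$ the input is constant, equal to $u(k)$, on $[kT,(k+1)T)$. Write $z(k)=\Psi(x(kT))$ and $z_{n+1}(k)=\alpha(z(k))+\beta(z(k))u(k)$. The inputs $u(k)=u^*_k$, $0\le k\le N$, are fixed in advance, and for $k\ge N$ $$u(k+1)=u(k)+\gamma\,\bigl(v(\hat z(k))-\hat z_{n+1}(k)\bigr),$$ where $\gamma>0$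 and the estimate $(\hat z(k),\hat z_{n+1}(k))\in\mathbb R^n\times\mathbb R$ is produced by an estimation technique from $T$, from the noise-free output $y$ on $[0,(k+1)T]$ and from $u(0),\dots,u(k)$. The technique is assumed to have error of order $T$: for every compact $D\subset\mathbb R^n\times\mathbb R$ there are $M,T_0>0$ such that, for all $T\in(0,T_0]$, all $k\ge N$ and every closed-loop trajectory on $[0,(k+1)T]$ along which $(\Psi(x),u)$ stays in $D$, $$\bigl\|(z(k)-\hat z(k),\,z_{n+1}(k)-\hat z_{n+1}(k))\bigr\|\le MT\,\|(z(k),u(k)-u_0)\|.$$ Let $e_u(k)=v(z(k))-(\alpha(z(k))+\beta(z(k))u(k))$. **Conclusion.** For every $N\in\mathbb N$, all fixed inputs $u^*_0,\dots,u^*_N$ and every compact set $\mathcal S\subset\mathbb R^n$ with $0$ in its interior there is $\gamma^*>0$, with $\gamma^*\ge\bar\beta^{-1}$ for every upper bound $\bar\beta$ of $\beta$ on $\mathbb R^n$, such that for every $\gamma\in(0,\gamma^*)$ and every such estimation technique there are $T^*>0$ and $b>0$ for which the following holds for all $T\in(0,T^*]$. From every $x(0)\in\mathcal S$ there is a closed-loop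 trajectory on $[0,\infty)$, and every closed-loop trajectory with $x(0)\in\mathcal S$ satisfies $\|(\hat z(k),\hat z_{n+1}(k))\|\le b$ for all $k\ge N$, $|e_u(k)|\le b$ for all $k\in\mathbb N$, $\|x(t)\|\le b$ for all $t\ge0$, and $\lim_{t\to\infty}x(t)=0$. -/

import Mathlib

open Set Filter Topology
open scoped ContDiff

noncomputable section

/-- The state space `ℝⁿ` with its Euclidean norm. -/
abbrev Sp (n : ℕ) : Type := EuclideanSpace ℝ (Fin n)

/-- The Euclidean norm of the vector `(z, w) ∈ ℝⁿ × ℝ`. -/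
def pairNorm {n : ℕ} (z : Sp n) (w : ℝ) : ℝ := Real.sqrt (‖z‖ ^ 2 + w ^ 2)

/-- The Lie derivative `L_f h` of the function `h` along the vector field `f`. -/
def lieD {n : ℕ} (f : Sp n → Sp n) (h : Sp n → ℝ) : Sp n → ℝ :=
  fun x => fderiv ℝ h x (f x)

/-- The coordinate map `Ψ(x) = (h(x), L_f h(x), …, L_f^{n-1} h(x))`. -/
def Psi {n : ℕ} (f : Sp n → Sp n) (h : Sp n → ℝ) (x : Sp n) : Sp n :=
  WithLp.toLp 2 (fun i : Fin n => ((lieD f)^[(i : ℕ)] h) x)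

/-- The inverse of the coordinate map (used only when `Ψ` is bijective). -/
def PsiInv {n : ℕ} (f : Sp n → Sp n) (h : Sp n → ℝ) : Sp n → Sp n :=
  Function.invFun (Psi f h)

/-- The drift `α = L_f^n h ∘ Ψ⁻¹` of the last equation in the coordinates `z = Ψ(x)`. -/
def alphaFn {n : ℕ} (f : Sp n → Sp n) (h : Sp n → ℝ) (z : Sp n) : ℝ :=
  ((lieD f)^[n] h) (PsiInv f h z)

/-- The control gain `β = L_g L_f^{n-1} h ∘ Ψ⁻¹` in the coordinates `z = Ψ(x)`. -/
def betaFn {n : ℕ} (f g : Sp n → Sp n) (h : Sp n → ℝ) (z : Sp n) : ℝ :=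
  (lieD g ((lieD f)^[n - 1] h)) (PsiInv f h z)

/-- The standing assumptions on the system `ẋ = f(x) + g(x) u`, `y = h(x)`: smooth data,
relative degree `n` on all of `ℝⁿ` with positive control gain, and the coordinate map `Ψ` is a
global diffeomorphism of `ℝⁿ` that fixes the origin. -/
structure FeedbackLinearizable {n : ℕ} (f g : Sp n → Sp n) (h : Sp n → ℝ) : Prop where
  smooth_f : ContDiff ℝ ∞ f
  smooth_g : ContDiff ℝ ∞ g
  smooth_h : ContDiff ℝ ∞ h
  relDegree : ∀ i : ℕ, i + 1 < n → ∀ x, lieD g ((lieD f)^[i] h) x = 0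
  gain_pos : ∀ x, 0 < lieD g ((lieD f)^[n - 1] h) x
  bijective : Function.Bijective (Psi f h)
  smooth_inv : ContDiff ℝ ∞ (PsiInv f h)
  map_zero : Psi f h 0 = 0

/-- The input `u₀ = -β(0)⁻¹ α(0)` that makes the origin an equilibrium. -/
def uZero {n : ℕ} (f g : Sp n → Sp n) (h : Sp n → ℝ) : ℝ :=
  -(betaFn f g h 0)⁻¹ * alphaFn f h 0

/-- The approximate discrete-time model `F_T^a(z, u)`: with coordinates numbered from `0`, its
`i`-th component is
`∑_{j ≥ i} z_j T^{j-i}/(j-i)! + (α(z) + β(z) u) T^{n-i}/(n-i)!`. -/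
def approxStep {n : ℕ} (f g : Sp n → Sp n) (h : Sp n → ℝ) (T : ℝ) (z : Sp n) (u : ℝ) : Sp n :=
  WithLp.toLp 2 (fun i : Fin n =>
    (∑ j : Fin n, if i ≤ j then
      z j * (T ^ ((j : ℕ) - (i : ℕ)) / (Nat.factorial ((j : ℕ) - (i : ℕ)) : ℝ)) else 0)
    + (alphaFn f h z + betaFn f g h z * u)
      * (T ^ (n - (i : ℕ)) / (Nat.factorial (n - (i : ℕ)) : ℝ)))

/-- The quadratic function `V_z(z) = zᵀ P z`. -/
def quadV {n : ℕ} (P : Matrix (Fin n) (Fin n) ℝ) (z : Sp n) : ℝ :=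
  dotProduct z.ofLp (P.mulVec z.ofLp)

/-- The preliminary controller `ū(z) = β(z)⁻¹ (-α(z) + v(z))`. -/
def uBar {n : ℕ} (f g : Sp n → Sp n) (h v : Sp n → ℝ) (z : Sp n) : ℝ :=
  (betaFn f g h z)⁻¹ * (-alphaFn f h z + v z)

/-- `V_z(F_T^a(z, ū)) - V_z(z) ≤ -λ T ‖z‖² + O_{(z, ū - u₀)²}(T²)`, the constants of the `O` term
being uniform on each compact set of `z`. -/
def LyapunovDecrease {n : ℕ} (f g : Sp n → Sp n) (h v : Sp n → ℝ)
    (P : Matrix (Fin n) (Fin n) ℝ) (lam : ℝ) : Prop :=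
  ∀ D : Set (Sp n), IsCompact D → ∃ M > 0, ∃ T₀ > 0, ∀ T : ℝ, 0 < T → T ≤ T₀ → ∀ z ∈ D,
    quadV P (approxStep f g h T z (uBar f g h v z)) - quadV P z
      ≤ -lam * T * ‖z‖ ^ 2 + M * T ^ 2 * pairNorm z (uBar f g h v z - uZero f g h) ^ 2

/-- `v(z + O_{(z, u - u₀)}(T)) = v(z) + O_{(z, u - u₀)}(T)`, the constants of the `O` terms being
uniform on each compact set of `(z, u)`. -/
def RobustInput {n : ℕ} (f g : Sp n → Sp n) (h v : Sp n → ℝ) : Prop :=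
  ∀ D : Set (Sp n × ℝ), IsCompact D → ∀ M₁ > 0, ∃ M₂ > 0, ∃ T₀ > 0,
    ∀ T : ℝ, 0 < T → T ≤ T₀ → ∀ p ∈ D, ∀ δ : Sp n,
      ‖δ‖ ≤ M₁ * T * pairNorm p.1 (p.2 - uZero f g h) →
        |v (p.1 + δ) - v p.1| ≤ M₂ * T * pairNorm p.1 (p.2 - uZero f g h)

/-- An estimation technique: from the sampling time `T`, the measured output `y`, the applied
inputs `u` and the step `k` it produces the estimate `(ẑ_1, …, ẑ_n)(k)` together with
`ẑ_{n+1}(k)`. -/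
abbrev Estimator (n : ℕ) : Type := ℝ → (ℝ → ℝ) → (ℕ → ℝ) → ℕ → Sp n × ℝ

/-- The `k`-th estimate uses only data available when it is needed, which is the time `(k+1)T`
at which the input `u(k+1)` starts to act. -/
def Estimator.IsCausal {n : ℕ} (est : Estimator n) : Prop :=
  ∀ T : ℝ, 0 < T → ∀ (y y' : ℝ → ℝ) (u u' : ℕ → ℝ) (k : ℕ),
    (∀ t ∈ Icc (0 : ℝ) (((k : ℝ) + 1) * T), y t = y' t) → (∀ j ≤ k, u j = u' j) →
      est T y u k = est T y' u' k

/-- `(x, u)` is a trajectory, over the first `K` sampling periods, of the closed loop formed by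
the sampled system and the dynamic controller
`u(k+1) = u(k) + γ (v(ẑ(k)) - ẑ_{n+1}(k))`, started with the fixed inputs `u*_0, …, u*_N`. -/
structure ClosedLoopUpTo {n : ℕ} (f g : Sp n → Sp n) (h v : Sp n → ℝ) (est : Estimator n)
    (γ : ℝ) (N : ℕ) (ustar : ℕ → ℝ) (T : ℝ) (K : ℕ) (x : ℝ → Sp n) (u : ℕ → ℝ) : Prop where
  ode : ∀ k < K, ∀ t ∈ Icc ((k : ℝ) * T) (((k : ℝ) + 1) * T),
    HasDerivWithinAt x (f (x t) + u k • g (x t))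
      (Icc ((k : ℝ) * T) (((k : ℝ) + 1) * T)) t
  transient : ∀ k < K, k ≤ N → u k = ustar k
  control : ∀ k, N ≤ k → k + 1 < K →
    u (k + 1) = u k + γ * (v (est T (h ∘ x) u k).1 - (est T (h ∘ x) u k).2)

/-- A closed-loop trajectory on `[0, ∞)`. -/
def ClosedLoop {n : ℕ} (f g : Sp n → Sp n) (h v : Sp n → ℝ) (est : Estimator n)
    (γ : ℝ) (N : ℕ) (ustar : ℕ → ℝ) (T : ℝ) (x : ℝ → Sp n) (u : ℕ → ℝ) : Prop :=
  ∀ K : ℕ, ClosedLoopUpTo f g h v est γ N ustar T K x u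

/-- The state `z(t) = Ψ(x(t))` at the sampling instant `t = kT`. -/
def zAt {n : ℕ} (f : Sp n → Sp n) (h : Sp n → ℝ) (T : ℝ) (x : ℝ → Sp n) (k : ℕ) : Sp n :=
  Psi f h (x ((k : ℝ) * T))

/-- The additional state `z_{n+1}(k) = α(z(k)) + β(z(k)) u(k)`. -/
def zExtra {n : ℕ} (f g : Sp n → Sp n) (h : Sp n → ℝ) (T : ℝ) (x : ℝ → Sp n) (u : ℕ → ℝ)
    (k : ℕ) : ℝ :=
  alphaFn f h (zAt f h T x k) + betaFn f g h (zAt f h T x k) * u k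

/-- The estimation error is `e_z = O_{(z, u - u₀)}(T)` along closed-loop trajectories, the
constants being uniform for the trajectories that evolve in a given compact set of `(z, u)`. -/
def EstimationError {n : ℕ} (f g : Sp n → Sp n) (h v : Sp n → ℝ) (est : Estimator n)
    (γ : ℝ) (N : ℕ) (ustar : ℕ → ℝ) : Prop :=
  ∀ D : Set (Sp n × ℝ), IsCompact D → ∃ M > 0, ∃ T₀ > 0, ∀ T : ℝ, 0 < T → T ≤ T₀ →
    ∀ k, N ≤ k → ∀ (x : ℝ → Sp n) (u : ℕ → ℝ),
      ClosedLoopUpTo f g h v est γ N ustar T (k + 1) x u →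
      (∀ j ≤ k, ∀ t ∈ Icc ((j : ℝ) * T) (((j : ℝ) + 1) * T), (Psi f h (x t), u j) ∈ D) →
        pairNorm (zAt f h T x k - (est T (h ∘ x) u k).1)
            (zExtra f g h T x u k - (est T (h ∘ x) u k).2)
          ≤ M * T * pairNorm (zAt f h T x k) (u k - uZero f g h)

/-- The input error `e_u(k) = v(z(k)) - (α(z(k)) + β(z(k)) u(k))`. -/
def inputError {n : ℕ} (f g : Sp n → Sp n) (h v : Sp n → ℝ) (T : ℝ) (x : ℝ → Sp n)
    (u : ℕ → ℝ) (k : ℕ) : ℝ :=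
  v (zAt f h T x k) - zExtra f g h T x u k

end

/-! In the coordinates `z = Ψ(x)` the plant is a chain of integrators whose last derivative is `v(z)
- e`, with `e` the input error. The proof rests on two time scales. Substituting the update law
gives `e(k+1) = (1 - γ β(z)) e(k) + O(T)`, and `0 ≤ 1 - γ β ≤ ρ < 1` on a ball once `γ` is below the
inverse of the maximum of `β` there: `e` contracts at a rate independent of `T` (`stateError_step`,
`exists_gain`). Meanwhile `z` moves by `O(T)` per period, and `V_z` loses `λ T ‖z‖²` up to a
coupling `T |e| ‖z‖` and a remainder of order `T²` (`quadV_step`). For small `T` Young's inequality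
absorbs the coupling, so `V_z + e²` shrinks by a factor `1 - κ T` (`composite_contraction`).

Convergence to the origin, rather than to a neighbourhood of it, needs every remainder to vanish at
the equilibrium. The remainders are proportional to `‖z‖ + |u - u₀|`, which `input_le_stateError`
bounds by a multiple of `‖z‖ + |e|`. This uses `v 0 = 0`, a consequence of the Lyapunov decrease.

All constants are uniform only on compact sets, so a region is fixed beforehand
(`exists_loopRegion`): for small `T` the first `N` periods move `z` by at most `1`, and from then on
a sublevel set of `V_z + e²` is invariant. Induction over the periods (`exists_loopBounds`) keeps
trajectories in the region, where solutions exist for a uniform time; causality of the estimator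
allows the pieces to be glued. -/

noncomputable section

/-! ### Lipschitz bounds on balls and the regularity of `v`. -/

/-- Lipschitz continuity on every ball centred at the origin. -/
def LipschitzOnBalls {E F : Type*} [NormedAddCommGroup E] [NormedAddCommGroup F]
    (φ : E → F) : Prop :=
  ∀ R : ℝ, ∃ L > 0, ∀ x y, ‖x‖ ≤ R → ‖y‖ ≤ R → ‖φ x - φ y‖ ≤ L * ‖x - y‖

namespace LipschitzOnBalls

variable {E F : Type*} [NormedAddCommGroup E] [NormedAddCommGroup F]

theorem of_contDiff [NormedSpace ℝ E] [NormedSpace ℝ F] [ProperSpace E] {φ : E → F}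
    (hφ : ContDiff ℝ 1 φ) : LipschitzOnBalls φ := by
  intro R
  obtain ⟨K, hK⟩ := (hφ.locallyLipschitz.locallyLipschitzOn
    (s := Metric.closedBall 0 R)).exists_lipschitzOnWith_of_compact (isCompact_closedBall 0 R)
  refine ⟨K + 1, by positivity, fun x y hx hy => ?_⟩
  have h := hK.dist_le_mul x (by simpa using hx) y (by simpa using hy)
  rw [dist_eq_norm, dist_eq_norm] at h
  nlinarith [norm_nonneg (x - y)]

theorem bounded {φ : E → F} (hφ : LipschitzOnBalls φ) (R : ℝ) :
    ∃ b > 0, ∀ x, ‖x‖ ≤ R → ‖φ x‖ ≤ b := by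
  obtain ⟨L, hL, h⟩ := hφ |R|
  refine ⟨L * |R| + ‖φ 0‖ + 1, by positivity, fun x hx => ?_⟩
  have h1 := h x 0 (hx.trans (le_abs_self R)) (by simp)
  rw [sub_zero] at h1
  have h2 := norm_le_norm_add_norm_sub' (φ x) (φ 0)
  have h3 : L * ‖x‖ ≤ L * |R| := by gcongr; exact hx.trans (le_abs_self R)
  linarith

end LipschitzOnBalls

section PairNorm

variable {n : ℕ}

theorem pairNorm_le (z : Sp n) (w : ℝ) : pairNorm z w ≤ ‖z‖ + |w| := by
  unfold pairNorm
  rw [Real.sqrt_le_left (by positivity)]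
  nlinarith [sq_abs w, mul_nonneg (norm_nonneg z) (abs_nonneg w)]

theorem norm_le_pairNorm (z : Sp n) (w : ℝ) : ‖z‖ ≤ pairNorm z w :=
  Real.le_sqrt_of_sq_le (by nlinarith [sq_nonneg w])

theorem abs_le_pairNorm (z : Sp n) (w : ℝ) : |w| ≤ pairNorm z w :=
  Real.abs_le_sqrt (by nlinarith [sq_nonneg ‖z‖])

end PairNorm

/-- In the hypothesis `T` is a free small parameter. With `u = u₀ + 1` the norm `q` of `(x, u - u₀)`
is at least `1`, and `T = ‖x - y‖ / q` turns the `O(T)` bound into a Lipschitz bound for nearby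
points. For distant points boundedness of `v` on the ball suffices. -/
theorem RobustInput.lipschitzOnBalls {n : ℕ} {f g : Sp n → Sp n} {h v : Sp n → ℝ}
    (hv : RobustInput f g h v) : LipschitzOnBalls v := by
  have key : ∀ R : ℝ, ∃ L > 0, ∃ ε > 0, ∀ x y, ‖x‖ ≤ R → ‖x - y‖ ≤ ε →
      |v x - v y| ≤ L * ‖x - y‖ := by
    intro R
    obtain ⟨M, hM, T₀, hT₀, H⟩ := hv (Metric.closedBall 0 R ×ˢ {uZero f g h + 1})
      ((isCompact_closedBall 0 R).prod isCompact_singleton) 1 one_pos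
    refine ⟨M, hM, T₀, hT₀, fun x y hx hxy => ?_⟩
    rcases eq_or_ne x y with rfl | hne
    · simp
    have hpos : 0 < ‖x - y‖ := norm_pos_iff.2 (sub_ne_zero.2 hne)
    have hq : 1 ≤ pairNorm x (uZero f g h + 1 - uZero f g h) := by
      simpa using abs_le_pairNorm x (uZero f g h + 1 - uZero f g h)
    set q := pairNorm x (uZero f g h + 1 - uZero f g h)
    have hTq : ‖x - y‖ / q * q = ‖x - y‖ := div_mul_cancel₀ _ (by linarith)
    have h1 := H (‖x - y‖ / q) (by positivity)
      ((div_le_self hpos.le hq).trans hxy) (x, uZero f g h + 1)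
      ⟨by simpa using hx, rfl⟩ (y - x) (by
        change ‖y - x‖ ≤ 1 * (‖x - y‖ / q) * q
        rw [one_mul, hTq, norm_sub_rev])
    change |v (x + (y - x)) - v x| ≤ M * (‖x - y‖ / q) * q at h1
    rwa [add_sub_cancel, mul_assoc, hTq, abs_sub_comm] at h1
  have hcont : Continuous v := by
    rw [continuous_iff_continuousAt]
    intro x
    obtain ⟨L, hL, ε, hε, H⟩ := key ‖x‖
    refine continuousAt_of_locally_lipschitz hε L fun y hy => ?_
    have := H x y le_rfl (by rw [← dist_eq_norm, dist_comm]; exact hy.le)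
    rwa [dist_comm, dist_comm y x, dist_eq_norm, dist_eq_norm]
  intro R
  obtain ⟨L, hL, ε, hε, H⟩ := key R
  obtain ⟨b, hb⟩ := (isCompact_closedBall (0 : Sp n) R).exists_bound_of_continuousOn
    hcont.continuousOn
  refine ⟨L + 2 * |b| / ε, by positivity, fun x y hx hy => ?_⟩
  rcases le_or_gt ‖x - y‖ ε with hc | hc
  · refine (H x y hx hc).trans ?_
    gcongr
    have : 0 ≤ 2 * |b| / ε := by positivity
    linarith
  · have h1 : ‖v x - v y‖ ≤ 2 * |b| := by
      have hx' := hb x (by simpa using hx)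
      have hy' := hb y (by simpa using hy)
      linarith [norm_sub_le (v x) (v y), le_abs_self b]
    have h2 : 2 * |b| ≤ 2 * |b| / ε * ‖x - y‖ := by
      rw [div_mul_eq_mul_div, le_div_iff₀ hε]
      gcongr
    nlinarith [norm_nonneg (x - y)]

/-! ### Short-time estimates for a flow with constant input. -/

section Flow

variable {E : Type*} [NormedAddCommGroup E] [NormedSpace ℝ E]

/-- Over a short interval, a trajectory of `ζ' = G(ζ, u)` with constant input is close to its
initial point, and to its explicit Euler step. -/
theorem flow_estimate {G : E → ℝ → E} {u₀ : ℝ}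
    (hG : ∀ R U : ℝ, ∃ L > 0, ∀ u, |u| ≤ U → ∀ z, ‖z‖ ≤ R →
      ‖G z u‖ ≤ L * (‖z‖ + |u - u₀|) ∧ ∀ z', ‖z'‖ ≤ R → ‖G z u - G z' u‖ ≤ L * ‖z - z'‖)
    (R U : ℝ) :
    ∃ C > 0, ∃ T₀ > 0, ∀ T, 0 < T → T ≤ T₀ → ∀ (a : ℝ) (ζ : ℝ → E) (u : ℝ), |u| ≤ U →
      ‖ζ a‖ ≤ R →
      (∀ t ∈ Icc a (a + T), HasDerivWithinAt ζ (G (ζ t) u) (Icc a (a + T)) t) →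
      (∀ t ∈ Icc a (a + T), ‖ζ t - ζ a‖ ≤ C * T * (‖ζ a‖ + |u - u₀|)) ∧
      ‖ζ (a + T) - ζ a - T • G (ζ a) u‖ ≤ C * T ^ 2 * (‖ζ a‖ + |u - u₀|) := by
  obtain ⟨L, hL, H⟩ := hG (R + 1) U
  set Q := |R| + |U| + |u₀| + 1 with hQ
  have hQ1 : 1 ≤ Q := by rw [hQ]; linarith [abs_nonneg R, abs_nonneg U, abs_nonneg u₀]
  refine ⟨max (2 * L) (2 * L ^ 2), by positivity, 1 / (4 * L * Q), by positivity, ?_⟩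
  intro T hT hTT a ζ u hu hζ hode
  set q := ‖ζ a‖ + |u - u₀| with hq
  have hq0 : 0 ≤ q := by positivity
  have hqQ : q + 1 ≤ Q := by
    have := abs_sub u u₀
    rw [hq, hQ]
    linarith [le_abs_self R, le_abs_self U]
  have hTL : T * (4 * L * Q) ≤ 1 := by
    rwa [le_div_iff₀ (by positivity)] at hTT
  have hTL4 : T * L ≤ 1 / 4 := by
    have : T * L * 1 ≤ T * L * Q := by gcongr
    linarith
  have hcont : ContinuousOn ζ (Icc a (a + T)) := fun t ht => (hode t ht).continuousWithinAt
  -- The comparison principle needs a strict inequality of slopes at a contact point, which fails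
  -- for `q = 0`; hence the perturbation by `ε`, removed in the limit. At a contact point the
  -- deviation is at most `1`, so the Lipschitz bound on the ball of radius `R + 1` applies.
  have hmain : ∀ ε, 0 < ε → ε ≤ 1 → ∀ t ∈ Icc a (a + T),
      ‖ζ t - ζ a‖ ≤ 2 * L * (q + ε) * (t - a) := by
    intro ε hε hε1
    have hrange : ∀ t ∈ Icc a (a + T), 2 * L * (q + ε) * (t - a) ≤ 2 * L * (q + ε) * T := by
      intro t ht
      have : t - a ≤ T := by linarith [ht.2]
      gcongr
    have h1 : 2 * L * (q + ε) * T ≤ 1 := by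
      have : 2 * L * (q + ε) * T ≤ 2 * L * Q * T := by gcongr; linarith
      linarith
    refine image_norm_le_of_norm_deriv_right_lt_deriv_boundary' (f' := fun t => G (ζ t) u)
      (B' := fun _ => 2 * L * (q + ε)) (hcont.sub continuousOn_const) ?_ (by simp)
      (by fun_prop) ?_ ?_
    · intro t ht
      exact ((hode t (Ico_subset_Icc_self ht)).sub_const _).mono_of_mem_nhdsWithin
        (Icc_mem_nhdsGE_of_mem ht)
    · intro t _
      have := ((hasDerivAt_id t).sub_const a).const_mul (2 * L * (q + ε))
      simpa using this.hasDerivWithinAt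
    · intro t ht heq
      have ht' := Ico_subset_Icc_self ht
      have hle : ‖ζ t - ζ a‖ ≤ 2 * L * (q + ε) * T := heq.le.trans (hrange t ht')
      have hball : ‖ζ t‖ ≤ R + 1 := by
        linarith [norm_le_norm_add_norm_sub' (ζ t) (ζ a)]
      have h2 := (H u hu (ζ a) (by linarith)).1
      have h3 := (H u hu (ζ t) hball).2 (ζ a) (by linarith)
      have h4 := norm_le_norm_add_norm_sub' (G (ζ t) u) (G (ζ a) u)
      have h5 : L * ‖ζ t - ζ a‖ ≤ L * (2 * L * (q + ε) * T) := by gcongr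
      have h6 : L * (2 * L * (q + ε) * T) ≤ 1 / 2 * (L * (q + ε)) := by
        have : (T * L) * (2 * (L * (q + ε))) ≤ 1 / 4 * (2 * (L * (q + ε))) := by gcongr
        linarith
      have h7 : 0 < L * ε := by positivity
      have h8 : 0 ≤ L * q := by positivity
      linarith
  have hlin : ∀ t ∈ Icc a (a + T), ‖ζ t - ζ a‖ ≤ 2 * L * q * (t - a) := by
    intro t ht
    have hlim : Tendsto (fun ε : ℝ => 2 * L * (q + ε) * (t - a)) (𝓝[>] 0)
        (𝓝 (2 * L * q * (t - a))) := by
      refine (Continuous.tendsto' (by fun_prop) 0 _ (by simp)).mono_left nhdsWithin_le_nhds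
    refine ge_of_tendsto hlim ?_
    filter_upwards [Ioc_mem_nhdsGT (zero_lt_one' ℝ)] with ε hε
    exact hmain ε hε.1 hε.2 t ht
  have hT' : ∀ t ∈ Icc a (a + T), ‖ζ t - ζ a‖ ≤ 2 * L * T * q := by
    intro t ht
    refine (hlin t ht).trans ?_
    have : t - a ≤ T := by linarith [ht.2]
    calc 2 * L * q * (t - a) ≤ 2 * L * q * T := by gcongr
      _ = _ := by ring
  refine ⟨fun t ht => (hT' t ht).trans ?_, ?_⟩
  · gcongr
    exact le_max_left _ _
  · have hsmall : 2 * L * T * q ≤ 1 := by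
      have : 2 * L * T * q ≤ 2 * L * T * Q := by gcongr; linarith
      nlinarith
    -- After subtraction of the Euler line the derivative is `G(ζ t) - G(ζ a)`, of size `O(T q)`;
    -- integration over one period gives `O(T² q)`.
    have hd : ∀ t ∈ Icc a (a + T),
        HasDerivWithinAt (fun t => ζ t - (t - a) • G (ζ a) u) (G (ζ t) u - G (ζ a) u)
          (Icc a (a + T)) t := by
      intro t ht
      have h1 := (((hasDerivAt_id t).sub_const a).smul_const (G (ζ a) u)).hasDerivWithinAt
        (s := Icc a (a + T))
      rw [one_smul] at h1
      exact (hode t ht).sub h1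
    have := norm_image_sub_le_of_norm_deriv_le_segment' (C := L * (2 * L * T * q)) hd (by
      intro t ht
      have ht' := Ico_subset_Icc_self ht
      have hball : ‖ζ t‖ ≤ R + 1 := by
        linarith [norm_le_norm_add_norm_sub' (ζ t) (ζ a), hT' t ht']
      refine ((H u hu (ζ t) hball).2 (ζ a) (by linarith)).trans ?_
      have := hT' t ht'
      gcongr) (a + T) ⟨by linarith, le_rfl⟩
    rw [add_sub_cancel_left, sub_self, zero_smul, sub_zero] at this
    rw [sub_right_comm]
    refine this.trans ?_
    calc L * (2 * L * T * q) * T = 2 * L ^ 2 * T ^ 2 * q := by ring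
      _ ≤ _ := by gcongr; exact le_max_right _ _

end Flow

/-! ### The scalar inequality behind the contraction. -/

set_option maxHeartbeats 800000 in
/-- The composite function `V + c e²` contracts by a factor `1 - κ T` when `V` decreases at the
rate `λ T |z|²` and `e` contracts at a rate independent of `T`, up to the stated couplings. -/
theorem composite_contraction {m lam C c ρ : ℝ} (hm : 0 < m) (hlam : 0 < lam) (hC : 0 < C)
    (hc : 0 < c) (hρ₀ : 0 ≤ ρ) (hρ : ρ < 1) :
    ∃ κ > 0, ∃ T₀ > 0, ∀ T, 0 < T → T ≤ T₀ → κ * T ≤ 1 ∧ ∀ z V V' e e' q r : ℝ,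
      0 ≤ z → 0 ≤ q → V ≤ m * z ^ 2 → q ≤ C * (z + |e|) → 0 ≤ r → r ≤ ρ →
      V' ≤ V - lam * T * z ^ 2 + C * T * |e| * z + C * T ^ 2 * q ^ 2 →
      |e' - r * e| ≤ C * T * q →
      V' + c * e' ^ 2 ≤ (1 - κ * T) * (V + c * e ^ 2) := by
  set σ := 1 - ρ ^ 2 with hσ
  have hσ0 : 0 < σ := by nlinarith
  -- `C₁` dominates the coefficients of `T |e| z` and `T² z²`, and `2 C₁` that of `T e²`, once `q`
  -- is eliminated; `C₂` adds the remainder of Young's inequality.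
  set C₁ := C + 2 * C ^ 3 + 2 * c * C ^ 2 + 2 * c * C ^ 4 with hC₁
  have hC₁0 : 0 < C₁ := by positivity
  set C₂ := 2 * C₁ + C₁ ^ 2 / lam with hC₂
  have hC₂0 : 0 < C₂ := by positivity
  -- Budget: of `λ T z²`, a quarter pays for the cross term, a quarter for the `T² z²` term and a
  -- half for `κ T V`. Of `c σ e²`, a half pays for `C₂ T e²` and a half for `κ T c e²`.
  refine ⟨min (lam / (2 * m)) (σ / 2), by positivity,
    min 1 (min (lam / (4 * C₁)) (c * σ / (2 * C₂))), by positivity, ?_⟩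
  intro T hT hTT
  have hT1 : T ≤ 1 := hTT.trans (min_le_left _ _)
  have hT2 : T * (4 * C₁) ≤ lam := by
    have := hTT.trans ((min_le_right _ _).trans (min_le_left _ _))
    rwa [le_div_iff₀ (by positivity)] at this
  have hT3 : T * (2 * C₂) ≤ c * σ := by
    have := hTT.trans ((min_le_right _ _).trans (min_le_right _ _))
    rwa [le_div_iff₀ (by positivity)] at this
  set κ := min (lam / (2 * m)) (σ / 2)
  have hκ0 : 0 < κ := by positivity
  have hκ1 : κ * (2 * m) ≤ lam := by
    have : κ ≤ lam / (2 * m) := min_le_left _ _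
    rwa [le_div_iff₀ (by positivity)] at this
  have hκ2 : κ ≤ σ / 2 := min_le_right _ _
  have hσ1 : σ ≤ 1 := by nlinarith
  have hκT : κ * T ≤ κ := by nlinarith
  refine ⟨by linarith, ?_⟩
  intro z V V' e e' q r hz hq hV hqe hr0 hr hV' he'
  set a := |e| with ha
  have ha0 : 0 ≤ a := abs_nonneg e
  have hae : a ^ 2 = e ^ 2 := sq_abs e
  have hq2 : q ^ 2 ≤ 2 * C ^ 2 * (z ^ 2 + a ^ 2) := by
    have : q ^ 2 ≤ (C * (z + a)) ^ 2 := by gcongr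
    linarith only [this, mul_nonneg (sq_nonneg C) (sq_nonneg (z - a))]
  have haq : a * q ≤ C * (a * z + a ^ 2) := by
    have : a * q ≤ a * (C * (z + a)) := by gcongr
    linarith
  have he1 : |e'| ≤ ρ * a + C * T * q := by
    have h1 : |e'| ≤ |r * e| + |e' - r * e| := by
      have := abs_add_le (r * e) (e' - r * e)
      rwa [add_sub_cancel] at this
    rw [abs_mul, abs_of_nonneg hr0] at h1
    have : r * |e| ≤ ρ * a := by gcongr
    linarith
  have he2 : e' ^ 2 ≤ ρ ^ 2 * a ^ 2 + 2 * C * T * (a * q) + C ^ 2 * T ^ 2 * q ^ 2 := by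
    have h1 : e' ^ 2 ≤ (ρ * a + C * T * q) ^ 2 := by
      rw [← sq_abs e']; gcongr
    have h2 : ρ * (2 * C * T * (a * q)) ≤ 1 * (2 * C * T * (a * q)) := by gcongr
    linarith only [h1, h2]
  have hbound : V' + c * e' ^ 2 ≤ V - lam * T * z ^ 2 + C₁ * T * (a * z) + C₁ * T ^ 2 * z ^ 2
      + 2 * C₁ * T * a ^ 2 + c * ρ ^ 2 * a ^ 2 := by
    have h1 : C * T ^ 2 * q ^ 2 ≤ C * T ^ 2 * (2 * C ^ 2 * (z ^ 2 + a ^ 2)) := by gcongr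
    have h2 : c * e' ^ 2 ≤ c * (ρ ^ 2 * a ^ 2 + 2 * C * T * (C * (a * z + a ^ 2))
        + C ^ 2 * T ^ 2 * (2 * C ^ 2 * (z ^ 2 + a ^ 2))) := by
      refine mul_le_mul_of_nonneg_left (he2.trans ?_) hc.le
      gcongr
    have hX : 0 ≤ T * (a * z) := by positivity
    have hY : 0 ≤ T ^ 2 * z ^ 2 := by positivity
    have hZ : 0 ≤ T * a ^ 2 := by positivity
    have hWZ : T ^ 2 * a ^ 2 ≤ T * a ^ 2 := by
      have : T ^ 2 ≤ T := by nlinarith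
      gcongr
    have e1 : C * T ^ 2 * (2 * C ^ 2 * (z ^ 2 + a ^ 2))
        = 2 * C ^ 3 * (T ^ 2 * z ^ 2) + 2 * C ^ 3 * (T ^ 2 * a ^ 2) := by ring
    have e2 : c * (ρ ^ 2 * a ^ 2 + 2 * C * T * (C * (a * z + a ^ 2))
        + C ^ 2 * T ^ 2 * (2 * C ^ 2 * (z ^ 2 + a ^ 2))) = c * ρ ^ 2 * a ^ 2
        + 2 * c * C ^ 2 * (T * (a * z)) + 2 * c * C ^ 2 * (T * a ^ 2)
        + 2 * c * C ^ 4 * (T ^ 2 * z ^ 2) + 2 * c * C ^ 4 * (T ^ 2 * a ^ 2) := by ring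
    have e3 : C₁ * T * (a * z) = C₁ * (T * (a * z)) := by ring
    have e4 : C₁ * T ^ 2 * z ^ 2 = C₁ * (T ^ 2 * z ^ 2) := by ring
    have e5 : 2 * C₁ * T * a ^ 2 = C₁ * (T * a ^ 2) + C₁ * (T * a ^ 2) := by ring
    have e6 : C * T * a * z = C * (T * (a * z)) := by ring
    have k1 : C + 2 * c * C ^ 2 ≤ C₁ := by
      have : 0 ≤ 2 * C ^ 3 + 2 * c * C ^ 4 := by positivity
      linarith
    have k2 : 2 * C ^ 3 + 2 * c * C ^ 4 ≤ C₁ := by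
      have : 0 ≤ C + 2 * c * C ^ 2 := by positivity
      linarith
    have k3 : 2 * c * C ^ 2 ≤ C₁ := by linarith
    have j1 := mul_le_mul_of_nonneg_right k1 hX
    have j2 := mul_le_mul_of_nonneg_right k2 hY
    have j3 := mul_le_mul_of_nonneg_right k3 hZ
    have j4 := mul_le_mul_of_nonneg_right k2 hZ
    have j5 : (2 * C ^ 3 + 2 * c * C ^ 4) * (T ^ 2 * a ^ 2)
        ≤ (2 * C ^ 3 + 2 * c * C ^ 4) * (T * a ^ 2) := by gcongr
    rw [e1] at h1
    rw [e2] at h2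
    rw [e6] at hV'
    rw [e3, e4, e5]
    rw [add_mul] at j1 j2 j4 j5
    linarith only [h1, h2, hV', j1, j2, j3, j4, j5]
  have hcross : C₁ * (a * z) ≤ lam / 4 * z ^ 2 + C₁ ^ 2 / lam * a ^ 2 := by
    have h1 : 0 ≤ (lam / 2 * z - C₁ * a) ^ 2 / lam := by positivity
    have h2 : (lam / 2 * z - C₁ * a) ^ 2 / lam
        = lam / 4 * z ^ 2 + C₁ ^ 2 / lam * a ^ 2 - C₁ * (a * z) := by
      field_simp; ring
    linarith only [h1, h2]
  have h1 : C₁ * T * (a * z) ≤ T * (lam / 4 * z ^ 2 + C₁ ^ 2 / lam * a ^ 2) := by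
    have := mul_le_mul_of_nonneg_left hcross hT.le
    linarith only [this]
  have h2 : C₁ * T ^ 2 * z ^ 2 ≤ lam / 4 * T * z ^ 2 := by
    have : T * (4 * C₁) * (T * z ^ 2) ≤ lam * (T * z ^ 2) := by gcongr
    linarith only [this]
  have h3 : C₂ * T * a ^ 2 ≤ c * σ / 2 * a ^ 2 := by
    have : T * (2 * C₂) * a ^ 2 ≤ c * σ * a ^ 2 := by gcongr
    linarith only [this]
  have h4 : κ * T * V ≤ lam / 2 * T * z ^ 2 := by
    have i1 : κ * T * V ≤ κ * T * (m * z ^ 2) := by gcongr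
    have i2 : κ * (2 * m) * (T * z ^ 2) ≤ lam * (T * z ^ 2) := by gcongr
    linarith only [i1, i2]
  have h5 : κ * T * (c * a ^ 2) ≤ c * σ / 2 * a ^ 2 := by
    have : κ * T * (c * a ^ 2) ≤ σ / 2 * (c * a ^ 2) := by gcongr; linarith
    linarith
  rw [← hae]
  have h6 : c * ρ ^ 2 * a ^ 2 = c * a ^ 2 - c * σ * a ^ 2 := by rw [hσ]; ring
  have h7 : C₂ * T * a ^ 2 = 2 * C₁ * T * a ^ 2 + T * (C₁ ^ 2 / lam * a ^ 2) := by
    rw [hC₂]; ring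
  linarith only [hbound, h1, h2, h3, h4, h5, h6, h7]

/-! ### The chain of integrators. -/

section Coordinates

variable {n : ℕ}

/-- The nilpotent shift `(z_1, …, z_n) ↦ (z_2, …, z_n, 0)`. -/
def shiftCLM (n : ℕ) : Sp n →L[ℝ] Sp n :=
  LinearMap.toContinuousLinearMap
    { toFun := fun z => WithLp.toLp 2 fun i : Fin n =>
        if h : (i : ℕ) + 1 < n then z ⟨i + 1, h⟩ else 0
      map_add' := fun x y => by
        ext i
        by_cases h : (i : ℕ) + 1 < n <;> simp [h]
      map_smul' := fun c x => by
        ext i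
        by_cases h : (i : ℕ) + 1 < n <;> simp [h] }

theorem shiftCLM_apply (z : Sp n) (i : Fin n) :
    shiftCLM n z i = if h : (i : ℕ) + 1 < n then z ⟨i + 1, h⟩ else 0 := rfl

/-- The last vector of the standard basis. -/
def lastVec (n : ℕ) : Sp n := WithLp.toLp 2 fun i : Fin n => if (i : ℕ) + 1 = n then 1 else 0

theorem lastVec_apply (i : Fin n) : lastVec n i = if (i : ℕ) + 1 = n then 1 else 0 := rfl

theorem lastVec_ne_zero (hn : 1 ≤ n) : lastVec n ≠ 0 := by
  intro h
  have := congrArg (fun z : Sp n => z ⟨n - 1, by omega⟩) h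
  simp [lastVec_apply, Nat.sub_add_cancel hn] at this

/-- The system in the coordinates `z = Ψ(x)`. -/
def chainField (f g : Sp n → Sp n) (h : Sp n → ℝ) (z : Sp n) (u : ℝ) : Sp n :=
  shiftCLM n z + (alphaFn f h z + betaFn f g h z * u) • lastVec n

theorem lieD_contDiff {f : Sp n → Sp n} {h : Sp n → ℝ} (hf : ContDiff ℝ ∞ f)
    (hh : ContDiff ℝ ∞ h) : ContDiff ℝ ∞ (lieD f h) :=
  (hh.fderiv_right (m := ∞) (by simp)).clm_apply hf

theorem lieD_iterate_contDiff {f : Sp n → Sp n} {h : Sp n → ℝ} (hf : ContDiff ℝ ∞ f)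
    (hh : ContDiff ℝ ∞ h) (i : ℕ) : ContDiff ℝ ∞ ((lieD f)^[i] h) := by
  induction i with
  | zero => exact hh
  | succ i ih => rw [Function.iterate_succ_apply']; exact lieD_contDiff hf ih

namespace FeedbackLinearizable

variable {f g : Sp n → Sp n} {h : Sp n → ℝ}

theorem psi_contDiff (hs : FeedbackLinearizable f g h) : ContDiff ℝ ∞ (Psi f h) :=
  contDiff_euclidean.2 fun i => lieD_iterate_contDiff hs.smooth_f hs.smooth_h i

theorem psiInv_psi (hs : FeedbackLinearizable f g h) (x : Sp n) : PsiInv f h (Psi f h x) = x :=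
  Function.leftInverse_invFun hs.bijective.1 x

theorem psiInv_zero (hs : FeedbackLinearizable f g h) : PsiInv f h 0 = 0 := by
  simpa [hs.map_zero] using hs.psiInv_psi 0

theorem alphaFn_contDiff (hs : FeedbackLinearizable f g h) : ContDiff ℝ ∞ (alphaFn f h) :=
  (lieD_iterate_contDiff hs.smooth_f hs.smooth_h n).comp hs.smooth_inv

theorem betaFn_contDiff (hs : FeedbackLinearizable f g h) : ContDiff ℝ ∞ (betaFn f g h) :=
  (lieD_contDiff hs.smooth_g (lieD_iterate_contDiff hs.smooth_f hs.smooth_h (n - 1))).comp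
    hs.smooth_inv

theorem betaFn_pos (hs : FeedbackLinearizable f g h) (z : Sp n) : 0 < betaFn f g h z :=
  hs.gain_pos _

theorem alphaFn_lipschitz (hs : FeedbackLinearizable f g h) : LipschitzOnBalls (alphaFn f h) :=
  .of_contDiff (hs.alphaFn_contDiff.of_le (by simp))

theorem betaFn_lipschitz (hs : FeedbackLinearizable f g h) : LipschitzOnBalls (betaFn f g h) :=
  .of_contDiff (hs.betaFn_contDiff.of_le (by simp))

theorem alphaFn_add_uZero (hs : FeedbackLinearizable f g h) :
    alphaFn f h 0 + betaFn f g h 0 * uZero f g h = 0 := by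
  have := (hs.betaFn_pos 0).ne'
  unfold uZero
  field_simp
  ring

/-- A trajectory of the system is a trajectory of the chain of integrators in the coordinates
`z = Ψ(x)`. -/
theorem hasDerivWithinAt_psi (hs : FeedbackLinearizable f g h) {x : ℝ → Sp n} {u t : ℝ}
    {s : Set ℝ} (hx : HasDerivWithinAt x (f (x t) + u • g (x t)) s t) :
    HasDerivWithinAt (fun τ => Psi f h (x τ)) (chainField f g h (Psi f h (x t)) u) s t := by
  rw [hasDerivWithinAt_iff_hasFDerivWithinAt, hasFDerivWithinAt_euclidean]
  intro i
  have hd : HasFDerivAt ((lieD f)^[(i : ℕ)] h) (fderiv ℝ ((lieD f)^[(i : ℕ)] h) (x t)) (x t) :=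
    ((lieD_iterate_contDiff hs.smooth_f hs.smooth_h i).differentiable (by simp) _).hasFDerivAt
  have h1 := hd.comp_hasDerivWithinAt t hx
  refine h1.hasFDerivWithinAt.congr_fderiv ?_
  ext
  have e1 : fderiv ℝ ((lieD f)^[(i : ℕ)] h) (x t) (f (x t))
      = (lieD f)^[(i : ℕ) + 1] h (x t) := by
    rw [Function.iterate_succ_apply']; rfl
  have e2 : fderiv ℝ ((lieD f)^[(i : ℕ)] h) (x t) (g (x t))
      = lieD g ((lieD f)^[(i : ℕ)] h) (x t) := rfl
  -- The relative degree removes the input from every row but the last, where `α` and `β` appear by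
  -- definition.
  have e3 : chainField f g h (Psi f h (x t)) u i = (lieD f)^[(i : ℕ) + 1] h (x t)
      + u * lieD g ((lieD f)^[(i : ℕ)] h) (x t) := by
    unfold chainField alphaFn betaFn
    rw [PiLp.add_apply, PiLp.smul_apply, shiftCLM_apply, lastVec_apply, hs.psiInv_psi, smul_eq_mul]
    by_cases hi : (i : ℕ) + 1 < n
    · rw [dif_pos hi, if_neg hi.ne, hs.relDegree i hi]
      simp [Psi]
    · have hi' : (i : ℕ) + 1 = n := by omega
      rw [dif_neg hi, if_pos hi', hi', show (i : ℕ) = n - 1 by omega]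
      ring
  simpa [e1, e2] using e3.symm

/-- The field vanishes at `(0, u₀)`, so its Lipschitz bound also controls its size by the distance
to the equilibrium. The radius includes `|u₀|` so that this point lies in the ball. -/
theorem chainField_estimate (hs : FeedbackLinearizable f g h) (R U : ℝ) :
    ∃ L > 0, ∀ u, |u| ≤ U → ∀ z, ‖z‖ ≤ R →
      ‖chainField f g h z u‖ ≤ L * (‖z‖ + |u - uZero f g h|) ∧
      ∀ z', ‖z'‖ ≤ R → ‖chainField f g h z u - chainField f g h z' u‖ ≤ L * ‖z - z'‖ := by
  have hG : ContDiff ℝ ∞ fun p : Sp n × ℝ => chainField f g h p.1 p.2 := by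
    have h1 := hs.alphaFn_contDiff
    have h2 := hs.betaFn_contDiff
    unfold chainField
    fun_prop
  obtain ⟨L, hL, H⟩ := LipschitzOnBalls.of_contDiff (hG.of_le (m := 1) (by simp))
    (max |R| (max U |uZero f g h|))
  have hnorm : ∀ (z : Sp n) (u : ℝ), ‖z‖ ≤ |R| → |u| ≤ max U |uZero f g h| →
      ‖(z, u)‖ ≤ max |R| (max U |uZero f g h|) := fun z u hz hu => by
    rw [Prod.norm_mk]; exact max_le_max hz hu
  refine ⟨L, hL, fun u hu z hz => ⟨?_, fun z' hz' => ?_⟩⟩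
  · have h1 := H (z, u) (0, uZero f g h)
      (hnorm _ _ (hz.trans (le_abs_self R)) (hu.trans (le_max_left _ _)))
      (hnorm _ _ (by simp) (le_max_right _ _))
    have h2 : chainField f g h 0 (uZero f g h) = 0 := by
      simp [chainField, hs.alphaFn_add_uZero]
    beta_reduce at h1
    rw [h2, sub_zero, Prod.mk_sub_mk, sub_zero, Prod.norm_mk] at h1
    refine h1.trans ?_
    gcongr
    exact max_le (le_add_of_nonneg_right (abs_nonneg _)) (le_add_of_nonneg_left (norm_nonneg _))
  · have h1 := H (z, u) (z', u)
      (hnorm _ _ (hz.trans (le_abs_self R)) (hu.trans (le_max_left _ _)))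
      (hnorm _ _ (hz'.trans (le_abs_self R)) (hu.trans (le_max_left _ _)))
    rwa [Prod.mk_sub_mk, sub_self, Prod.norm_mk, norm_zero, max_eq_left (norm_nonneg _)] at h1

end FeedbackLinearizable

end Coordinates

/-! ### The quadratic Lyapunov function and the infinitesimal decrease. -/

section Lyapunov

variable {n : ℕ} {P : Matrix (Fin n) (Fin n) ℝ}

open Matrix in
theorem quadV_eq_inner (P : Matrix (Fin n) (Fin n) ℝ) (z : Sp n) :
    quadV P z = inner ℝ z (toEuclideanCLM (𝕜 := ℝ) P z) := by
  rw [inner_toEuclideanCLM]; rfl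

open Matrix in
theorem inner_toEuclideanCLM_comm (hP : P.PosDef) (x y : Sp n) :
    inner ℝ x (toEuclideanCLM (𝕜 := ℝ) P y) = inner ℝ y (toEuclideanCLM (𝕜 := ℝ) P x) := by
  have hT : Pᵀ = P := by simpa using hP.1.eq
  rw [inner_toEuclideanCLM, inner_toEuclideanCLM, dotProduct_mulVec, ← mulVec_transpose, hT,
    dotProduct_comm]

open Matrix in
theorem quadV_add (hP : P.PosDef) (z d : Sp n) :
    quadV P (z + d) = quadV P z + 2 * inner ℝ z (toEuclideanCLM (𝕜 := ℝ) P d) + quadV P d := by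
  simp only [quadV_eq_inner, map_add, inner_add_left, inner_add_right]
  rw [inner_toEuclideanCLM_comm hP d z]
  ring

open Matrix in
theorem quadV_le (P : Matrix (Fin n) (Fin n) ℝ) (z : Sp n) :
    quadV P z ≤ ‖toEuclideanCLM (𝕜 := ℝ) P‖ * ‖z‖ ^ 2 := by
  rw [quadV_eq_inner]
  refine (real_inner_le_norm _ _).trans ?_
  have := (toEuclideanCLM (𝕜 := ℝ) P).le_opNorm z
  nlinarith [norm_nonneg z]

theorem quadV_pos (hP : P.PosDef) {z : Sp n} (hz : z ≠ 0) : 0 < quadV P z := by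
  have := hP.dotProduct_mulVec_pos (x := z.ofLp) (by simpa using hz)
  simpa [quadV] using this

theorem quadV_smul (P : Matrix (Fin n) (Fin n) ℝ) (c : ℝ) (z : Sp n) :
    quadV P (c • z) = c ^ 2 * quadV P z := by
  simp only [quadV_eq_inner, map_smul, inner_smul_left, inner_smul_right]
  simp; ring

theorem quadV_continuous (P : Matrix (Fin n) (Fin n) ℝ) : Continuous (quadV (n := n) P) := by
  have : quadV (n := n) P = fun z => inner ℝ z (Matrix.toEuclideanCLM (𝕜 := ℝ) P z) :=
    funext (quadV_eq_inner P)
  rw [this]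
  fun_prop

theorem exists_le_quadV (hP : P.PosDef) : ∃ m > 0, ∀ z : Sp n, m * ‖z‖ ^ 2 ≤ quadV P z := by
  rcases (Metric.sphere (0 : Sp n) 1).eq_empty_or_nonempty with he | hne
  -- An empty unit sphere means that the space is trivial.
  · refine ⟨1, one_pos, fun z => ?_⟩
    have hz : z = 0 := by
      by_contra hz
      have : (‖z‖⁻¹ • z) ∈ Metric.sphere (0 : Sp n) 1 := by
        simp [norm_smul, inv_mul_cancel₀ (norm_ne_zero_iff.2 hz)]
      simp [he] at this
    simp [hz, quadV]
  · obtain ⟨z₀, hz₀, hmin⟩ := (isCompact_sphere (0 : Sp n) 1).exists_isMinOn hne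
      (quadV_continuous P).continuousOn
    have hz₀' : z₀ ≠ 0 := by
      rintro rfl
      simp at hz₀
    refine ⟨quadV P z₀, quadV_pos hP hz₀', fun z => ?_⟩
    rcases eq_or_ne z 0 with rfl | hz
    · simp [quadV]
    have hz' := norm_ne_zero_iff.2 hz
    have h1 : quadV P z₀ ≤ quadV P (‖z‖⁻¹ • z) :=
      hmin (by simp [norm_smul, inv_mul_cancel₀ hz'])
    rw [quadV_smul, inv_pow, ← div_eq_inv_mul, le_div_iff₀ (by positivity)] at h1
    exact h1

/-- At `T = 0` only first powers of `T` contribute: the entry `j = i + 1` and, in the last row, the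
input term. The approximate model thus has the first-order term of the exact flow, and this is all
that is needed of it. -/
theorem approxStep_hasDerivAt (f g : Sp n → Sp n) (h : Sp n → ℝ) (z : Sp n) (u : ℝ) :
    HasDerivAt (fun T => approxStep f g h T z u) (chainField f g h z u) 0 := by
  rw [← hasDerivWithinAt_univ, hasDerivWithinAt_iff_hasFDerivWithinAt,
    hasFDerivWithinAt_euclidean]
  intro i
  have hpow : ∀ m : ℕ, HasDerivAt (fun T : ℝ => T ^ m / (Nat.factorial m : ℝ))
      (if m = 1 then 1 else 0) 0 := by
    intro m
    have h1 := (hasDerivAt_pow m (0 : ℝ)).div_const (Nat.factorial m : ℝ)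
    refine h1.congr_deriv ?_
    rcases m with _ | _ | m <;> simp
  have hterm : ∀ j ∈ (Finset.univ : Finset (Fin n)), HasDerivAt (fun T : ℝ => if i ≤ j then
      z j * (T ^ ((j : ℕ) - (i : ℕ)) / (Nat.factorial ((j : ℕ) - (i : ℕ)) : ℝ)) else 0)
      (if (j : ℕ) = i + 1 then z j else 0) 0 := by
    intro j _
    by_cases hij : i ≤ j
    · simp only [hij, if_true]
      refine ((hpow ((j : ℕ) - i)).const_mul (z j)).congr_deriv ?_
      have : (i : ℕ) ≤ j := hij
      have : ((j : ℕ) - i = 1) ↔ (j : ℕ) = i + 1 := by omega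
      simp [this]
    · simp only [hij, if_false]
      have : ¬ (j : ℕ) = i + 1 := fun hj => hij (by rw [Fin.le_def]; omega)
      simp only [this, if_false]
      exact hasDerivAt_const _ _
  have hsum := (HasDerivAt.fun_sum hterm).add
    ((hpow (n - i)).const_mul (alphaFn f h z + betaFn f g h z * u))
  refine (hsum.hasDerivWithinAt.hasFDerivWithinAt).congr_fderiv ?_
  ext
  have e1 : (∑ j : Fin n, if (j : ℕ) = i + 1 then z j else 0) = shiftCLM n z i := by
    rw [shiftCLM_apply]
    by_cases hi : (i : ℕ) + 1 < n
    · rw [dif_pos hi, Finset.sum_eq_single ⟨i + 1, hi⟩]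
      · simp
      · intro j _ hj
        rw [if_neg]
        exact fun h' => hj (Fin.ext h')
      · simp
    · rw [dif_neg hi]
      refine Finset.sum_eq_zero fun j _ => if_neg ?_
      have := j.2
      omega
  have e2 : (n - (i : ℕ) = 1) ↔ (i : ℕ) + 1 = n := by have := i.2; omega
  simp [chainField, e1, e2, lastVec_apply]

theorem approxStep_zero (f g : Sp n → Sp n) (h : Sp n → ℝ) (z : Sp n) (u : ℝ) :
    approxStep f g h 0 z u = z := by
  ext i
  have hi : n - (i : ℕ) ≠ 0 := by have := i.2; omega
  simp only [approxStep, zero_pow hi, zero_div, mul_zero, add_zero]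
  rw [Finset.sum_eq_single i]
  · simp
  · intro j _ hj
    by_cases hij : i ≤ j
    · have : (j : ℕ) - i ≠ 0 := by
        have h1 : (i : ℕ) ≤ j := hij
        have h2 : (j : ℕ) ≠ i := fun h' => hj (Fin.ext h')
        omega
      simp [zero_pow this]
    · simp [hij]
  · simp

variable {f g : Sp n → Sp n} {h v : Sp n → ℝ} {lam : ℝ}

open Matrix in
/-- The infinitesimal form of the Lyapunov decrease. -/
theorem LyapunovDecrease.inner_le (hs : FeedbackLinearizable f g h) (hP : P.PosDef)
    (hv : LyapunovDecrease f g h v P lam) (z : Sp n) :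
    2 * inner ℝ z (toEuclideanCLM (𝕜 := ℝ) P (shiftCLM n z + v z • lastVec n))
      ≤ -lam * ‖z‖ ^ 2 := by
  obtain ⟨M, hM, T₀, hT₀, H⟩ := hv {z} isCompact_singleton
  have hw : alphaFn f h z + betaFn f g h z * uBar f g h v z = v z := by
    have := (hs.betaFn_pos z).ne'
    unfold uBar
    field_simp
    ring
  have hd := approxStep_hasDerivAt f g h z (uBar f g h v z)
  have hV : HasDerivAt (fun T => quadV P (approxStep f g h T z (uBar f g h v z)))
      (2 * inner ℝ z (toEuclideanCLM (𝕜 := ℝ) P (shiftCLM n z + v z • lastVec n))) 0 := by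
    have h1 := hd.inner ℝ ((toEuclideanCLM (𝕜 := ℝ) P).hasFDerivAt.comp_hasDerivAt (0 : ℝ) hd)
    simp only [quadV_eq_inner]
    refine h1.congr_deriv ?_
    simp only [Function.comp, approxStep_zero]
    rw [chainField, hw, inner_toEuclideanCLM_comm hP (shiftCLM n z + v z • lastVec n) z]
    ring
  -- Dividing the assumed decrease by `T` gives a right difference quotient of `V_z`; the `O(T²)`
  -- term disappears in the limit.
  have hslope := (hasDerivAt_iff_tendsto_slope.1 hV).mono_left
    (nhdsWithin_mono 0 (fun t ht => (ne_of_gt ht : t ≠ 0)) : 𝓝[>] (0 : ℝ) ≤ 𝓝[≠] 0)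
  set q := pairNorm z (uBar f g h v z - uZero f g h)
  have hlim : Tendsto (fun T : ℝ => -lam * ‖z‖ ^ 2 + M * T * q ^ 2) (𝓝[>] 0)
      (𝓝 (-lam * ‖z‖ ^ 2)) :=
    (Continuous.tendsto' (by fun_prop) 0 _ (by simp)).mono_left nhdsWithin_le_nhds
  refine le_of_tendsto_of_tendsto hslope hlim ?_
  filter_upwards [Ioc_mem_nhdsGT hT₀] with T hT
  have h1 := H T hT.1 hT.2 z rfl
  rw [slope_def_field, approxStep_zero, sub_zero, div_le_iff₀ hT.1]
  refine h1.trans (le_of_eq ?_)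
  ring

/-- Apply the infinitesimal decrease at `ε ξ`, divide by `ε` and let `ε → 0`: only `v(0) ⟨ξ, P e_n⟩
≤ 0` survives. Taking `ξ = ± e_n`, with `⟨e_n, P e_n⟩ > 0`, forces `v(0) = 0`. -/
theorem LyapunovDecrease.map_zero (hn : 1 ≤ n) (hs : FeedbackLinearizable f g h) (hP : P.PosDef)
    (hlam : 0 < lam) (hv : LyapunovDecrease f g h v P lam) (hvL : LipschitzOnBalls v) :
    v 0 = 0 := by
  have hcont : ContinuousAt v 0 := by
    obtain ⟨L, hL, H⟩ := hvL 1
    refine continuousAt_of_locally_lipschitz one_pos L fun y hy => ?_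
    rw [dist_zero_right] at hy
    simpa [dist_eq_norm] using H y 0 hy.le (by simp)
  set Q := Matrix.toEuclideanCLM (𝕜 := ℝ) P
  have key : ∀ ξ : Sp n, v 0 * inner ℝ ξ (Q (lastVec n)) ≤ 0 := by
    intro ξ
    have hlim : Tendsto (fun ε : ℝ => 2 * (ε * inner ℝ ξ (Q (shiftCLM n ξ))
        + v (ε • ξ) * inner ℝ ξ (Q (lastVec n)))) (𝓝[>] 0)
        (𝓝 (2 * (0 * inner ℝ ξ (Q (shiftCLM n ξ)) + v 0 * inner ℝ ξ (Q (lastVec n))))) := by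
      have h0 : Tendsto (fun ε : ℝ => ε • ξ) (𝓝[>] 0) (𝓝 0) :=
        (Continuous.tendsto' (by fun_prop) 0 _ (by simp)).mono_left nhdsWithin_le_nhds
      have h1 : Tendsto (fun ε : ℝ => v (ε • ξ)) (𝓝[>] 0) (𝓝 (v 0)) := hcont.tendsto.comp h0
      have h2 : Tendsto (fun ε : ℝ => ε) (𝓝[>] 0) (𝓝 0) := nhdsWithin_le_nhds
      exact ((h2.mul_const _).add (h1.mul_const _)).const_mul 2
    have : 2 * (0 * inner ℝ ξ (Q (shiftCLM n ξ)) + v 0 * inner ℝ ξ (Q (lastVec n))) ≤ 0 := by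
      refine le_of_tendsto hlim ?_
      filter_upwards [self_mem_nhdsWithin] with ε (hε : 0 < ε)
      have h1 := hv.inner_le hs hP (ε • ξ)
      change 2 * inner ℝ (ε • ξ) (Q _) ≤ _ at h1
      rw [map_add, map_smul, map_smul, map_smul, inner_add_right, inner_smul_left,
        inner_smul_left, inner_smul_right, inner_smul_right] at h1
      simp only [conj_trivial] at h1
      have h2 : 0 ≤ lam * ‖ε • ξ‖ ^ 2 := by positivity
      refine nonpos_of_mul_nonpos_right (a := ε) ?_ hε
      linarith
    linarith
  have hpos : 0 < inner ℝ (lastVec n) (Q (lastVec n)) := by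
    rw [← quadV_eq_inner]; exact quadV_pos hP (lastVec_ne_zero hn)
  have h1 := key (lastVec n)
  have h2 := key (-lastVec n)
  rw [inner_neg_left] at h2
  nlinarith

end Lyapunov

/-! ### One sampling period. -/

section Steps

variable {n : ℕ} {f g : Sp n → Sp n} {h v : Sp n → ℝ} {P : Matrix (Fin n) (Fin n) ℝ} {lam : ℝ}

/-- The input error `e_u` as a function of the state and the input. -/
def stateError (f g : Sp n → Sp n) (h v : Sp n → ℝ) (z : Sp n) (u : ℝ) : ℝ :=
  v z - (alphaFn f h z + betaFn f g h z * u)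

/-- The function `V_z + e_u²`. -/
def compositeV (f g : Sp n → Sp n) (h v : Sp n → ℝ) (P : Matrix (Fin n) (Fin n) ℝ)
    (z : Sp n) (u : ℝ) : ℝ :=
  quadV P z + stateError f g h v z u ^ 2

open Matrix in
/-- The change of `V_z` over one sampling period, and the intersample deviation. -/
theorem quadV_step (hs : FeedbackLinearizable f g h) (hP : P.PosDef)
    (hv : LyapunovDecrease f g h v P lam) (R U : ℝ) :
    ∃ C > 0, ∃ T₀ > 0, ∀ T, 0 < T → T ≤ T₀ → ∀ (a : ℝ) (x : ℝ → Sp n) (u : ℝ), |u| ≤ U →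
      ‖Psi f h (x a)‖ ≤ R →
      (∀ t ∈ Icc a (a + T), HasDerivWithinAt x (f (x t) + u • g (x t)) (Icc a (a + T)) t) →
      (∀ t ∈ Icc a (a + T), ‖Psi f h (x t) - Psi f h (x a)‖
        ≤ C * T * (‖Psi f h (x a)‖ + |u - uZero f g h|)) ∧
      quadV P (Psi f h (x (a + T))) ≤ quadV P (Psi f h (x a)) - lam * T * ‖Psi f h (x a)‖ ^ 2
        + C * T * |stateError f g h v (Psi f h (x a)) u| * ‖Psi f h (x a)‖
        + C * T ^ 2 * (‖Psi f h (x a)‖ + |u - uZero f g h|) ^ 2 := by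
  obtain ⟨C, hC, T₀, hT₀, H⟩ := flow_estimate hs.chainField_estimate R U
  set Q := toEuclideanCLM (𝕜 := ℝ) P with hQ
  set b := ‖Q (lastVec n)‖
  refine ⟨C + 2 * b + 2 * ‖Q‖ * C + ‖Q‖ * C ^ 2, by positivity, T₀, hT₀, ?_⟩
  intro T hT hTT a x u hu hx hode
  obtain ⟨h1, h2⟩ := H T hT hTT a (fun t => Psi f h (x t)) u hu hx
    fun t ht => hs.hasDerivWithinAt_psi (hode t ht)
  have hlast := h1 (a + T) ⟨by linarith, le_rfl⟩
  generalize Psi f h (x (a + T)) = z' at h2 hlast ⊢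
  set z := Psi f h (x a) with hz
  set q := ‖z‖ + |u - uZero f g h| with hq
  have hq0 : 0 ≤ q := by positivity
  have hzq : ‖z‖ ≤ q := le_add_of_nonneg_right (abs_nonneg _)
  refine ⟨fun t ht => (h1 t ht).trans ?_, ?_⟩
  · gcongr
    have : 0 ≤ 2 * b + 2 * ‖Q‖ * C + ‖Q‖ * C ^ 2 := by positivity
    linarith
  set e := stateError f g h v z u with he
  have hfield : chainField f g h z u = (shiftCLM n z + v z • lastVec n) - e • lastVec n := by
    have : alphaFn f h z + betaFn f g h z * u = v z - e := by rw [he, stateError]; ring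
    rw [chainField, this, sub_smul]
    abel
  set d := z' - z with hd
  set r := d - T • chainField f g h z u with hr
  have hz' : z' = z + d := by rw [hd]; abel
  have hdr : d = T • (shiftCLM n z + v z • lastVec n) - (T * e) • lastVec n + r := by
    rw [hr, hfield, smul_sub, smul_smul]; abel
  -- The increment splits into a step of the loop with ideal input `v(z)`, which yields the
  -- decrease, the contribution of `e`, which yields the coupling, and the Euler remainder `r`.
  have i1 : 2 * inner ℝ z (Q d) = T * (2 * inner ℝ z (Q (shiftCLM n z + v z • lastVec n)))
      - 2 * T * (e * inner ℝ z (Q (lastVec n))) + 2 * inner ℝ z (Q r) := by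
    conv_lhs => rw [hdr]
    simp only [map_add, map_sub, map_smul, inner_add_right, inner_sub_right, inner_smul_right]
    ring
  have i2 : T * (2 * inner ℝ z (Q (shiftCLM n z + v z • lastVec n))) ≤ T * (-lam * ‖z‖ ^ 2) :=
    mul_le_mul_of_nonneg_left (hv.inner_le hs hP z) hT.le
  have i3 : -(e * inner ℝ z (Q (lastVec n))) ≤ |e| * (‖z‖ * b) := by
    refine (neg_le_abs _).trans ?_
    rw [abs_mul]
    gcongr
    exact abs_real_inner_le_norm _ _
  have i4 : inner ℝ z (Q r) ≤ q * (‖Q‖ * (C * T ^ 2 * q)) := by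
    refine (real_inner_le_norm _ _).trans ?_
    have : ‖Q r‖ ≤ ‖Q‖ * (C * T ^ 2 * q) := (Q.le_opNorm r).trans (by gcongr)
    gcongr
  have i5 : quadV P d ≤ ‖Q‖ * (C * T * q) ^ 2 := by
    refine (quadV_le P d).trans ?_
    gcongr
  have i3' := mul_le_mul_of_nonneg_left i3 (by positivity : 0 ≤ 2 * T)
  rw [hz', quadV_add hP, ← hQ, i1]
  have p1 : 0 ≤ (C + 2 * ‖Q‖ * C + ‖Q‖ * C ^ 2) * (T * |e| * ‖z‖) := by positivity
  have p2 : 0 ≤ (C + 2 * b) * (T ^ 2 * q ^ 2) := by positivity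
  linarith only [i2, i3', i4, i5, p1, p2]

/-- The change of the input error when the controller is updated with estimates of error of
order `T`. -/
theorem stateError_step (hs : FeedbackLinearizable f g h) (hvL : LipschitzOnBalls v)
    (R U : ℝ) {M γ : ℝ} (hM : 0 < M) (hγ : 0 < γ) :
    ∃ C > 0, ∃ T₀ > 0, ∀ T, 0 < T → T ≤ T₀ → ∀ (z z' zh : Sp n) (u wh : ℝ), |u| ≤ U → ‖z‖ ≤ R →
      ‖z' - z‖ ≤ M * T * (‖z‖ + |u - uZero f g h|) →
      ‖z - zh‖ ≤ M * T * (‖z‖ + |u - uZero f g h|) →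
      |alphaFn f h z + betaFn f g h z * u - wh| ≤ M * T * (‖z‖ + |u - uZero f g h|) →
      |stateError f g h v z' (u + γ * (v zh - wh))
        - (1 - γ * betaFn f g h z) * stateError f g h v z u|
        ≤ C * T * (‖z‖ + |u - uZero f g h|) := by
  obtain ⟨La, hLa, Ha⟩ := hs.alphaFn_lipschitz (R + 1)
  obtain ⟨Lb, hLb, Hb⟩ := hs.betaFn_lipschitz (R + 1)
  obtain ⟨Lv, hLv, Hv⟩ := hvL (R + 1)
  obtain ⟨ba, hba, Ba⟩ := hs.alphaFn_lipschitz.bounded (R + 1)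
  obtain ⟨bb, hbb, Bb⟩ := hs.betaFn_lipschitz.bounded (R + 1)
  obtain ⟨bv, hbv, Bv⟩ := hvL.bounded (R + 1)
  set be := bv + (ba + bb * |U|) with hbe
  -- The bound on `T` gives `M T q ≤ 1`, which keeps `z'` and the estimate `zh` in the ball of
  -- radius `R + 1`.
  refine ⟨(Lv + La + Lb * |U| + γ * (Lb * be) + γ * (bb * (Lv + 1))) * M, by positivity,
    1 / (M * (|R| + |U| + |uZero f g h| + 1)), by positivity, ?_⟩
  intro T hT hTT z z' zh u wh hu hz hz' hzh hw
  set q := ‖z‖ + |u - uZero f g h|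
  have hU : |u| ≤ |U| := hu.trans (le_abs_self U)
  have hsmall : M * T * q ≤ 1 := by
    rw [le_div_iff₀ (by positivity)] at hTT
    have : q ≤ |R| + |U| + |uZero f g h| + 1 := by
      have := abs_sub u (uZero f g h)
      linarith [le_abs_self R]
    calc M * T * q ≤ M * T * (|R| + |U| + |uZero f g h| + 1) := by gcongr
      _ ≤ 1 := by linarith
  have hz1 : ‖z‖ ≤ R + 1 := by linarith
  have hz'1 : ‖z'‖ ≤ R + 1 := by linarith [norm_le_norm_add_norm_sub' z' z]
  have hzh1 : ‖zh‖ ≤ R + 1 := by linarith [norm_le_norm_add_norm_sub z zh]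
  have he : |stateError f g h v z u| ≤ be := by
    have h1 := Bv z hz1
    have h2 := Ba z hz1
    have h3 := Bb z hz1
    rw [Real.norm_eq_abs] at h1 h2 h3
    have h4 : |betaFn f g h z * u| ≤ bb * |U| := by rw [abs_mul]; gcongr
    have h5 := abs_add_le (alphaFn f h z) (betaFn f g h z * u)
    have h6 := abs_sub (v z) (alphaFn f h z + betaFn f g h z * u)
    rw [stateError, hbe]
    linarith
  set e := stateError f g h v z u with he_def
  set δ := v zh - wh - e with hδ
  have hδb : |δ| ≤ (Lv + 1) * (M * T * q) := by
    have h1 : δ = (v zh - v z) + (alphaFn f h z + betaFn f g h z * u - wh) := by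
      rw [hδ, he_def, stateError]; ring
    have h2 := Hv zh z hzh1 hz1
    rw [Real.norm_eq_abs, norm_sub_rev] at h2
    have h3 : Lv * ‖z - zh‖ ≤ Lv * (M * T * q) := by gcongr
    rw [h1]
    have h4 := abs_add_le (v zh - v z) (alphaFn f h z + betaFn f g h z * u - wh)
    linarith
  have h1 : |v z' - v z| ≤ Lv * (M * T * q) :=
    (Hv z' z hz'1 hz1).trans (by gcongr)
  have h2 : |alphaFn f h z' - alphaFn f h z| ≤ La * (M * T * q) :=
    (Ha z' z hz'1 hz1).trans (by gcongr)
  have h3 : |betaFn f g h z' - betaFn f g h z| ≤ Lb * (M * T * q) :=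
    (Hb z' z hz'1 hz1).trans (by gcongr)
  have h4 : |(betaFn f g h z' - betaFn f g h z) * u| ≤ Lb * (M * T * q) * |U| := by
    rw [abs_mul]; gcongr
  have h5 : |γ * ((betaFn f g h z' - betaFn f g h z) * e)| ≤ γ * (Lb * (M * T * q) * be) := by
    rw [abs_mul, abs_mul, abs_of_pos hγ]; gcongr
  have h6 : |γ * (betaFn f g h z' * δ)| ≤ γ * (bb * ((Lv + 1) * (M * T * q))) := by
    have := Bb z' hz'1
    rw [Real.norm_eq_abs] at this
    rw [abs_mul, abs_mul, abs_of_pos hγ]; gcongr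
  -- With the gain frozen at the old state `z`, every remaining term carries a factor of order `T
  -- q`: an increment of `v`, `α` or `β`, or the error `δ` with which the controller measures `e`.
  have hexp : stateError f g h v z' (u + γ * (v zh - wh)) - (1 - γ * betaFn f g h z) * e
      = (v z' - v z) - (alphaFn f h z' - alphaFn f h z)
        - (betaFn f g h z' - betaFn f g h z) * u
        - γ * ((betaFn f g h z' - betaFn f g h z) * e) - γ * (betaFn f g h z' * δ) := by
    have : v zh - wh = e + δ := by rw [hδ]; ring
    rw [this, stateError, he_def, stateError]
    ring
  rw [hexp]
  rw [abs_le] at h1 h2 h4 h5 h6 ⊢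
  constructor
  · linarith only [h1.1, h2.2, h4.2, h5.2, h6.2]
  · linarith only [h1.2, h2.1, h4.1, h5.1, h6.1]

theorem betaFn_inv_bounded (hs : FeedbackLinearizable f g h) (R : ℝ) :
    ∃ b > 0, ∀ z, ‖z‖ ≤ R → (betaFn f g h z)⁻¹ ≤ b := by
  have hd : ContDiff ℝ ∞ fun z => (betaFn f g h z)⁻¹ :=
    hs.betaFn_contDiff.inv fun z => (hs.betaFn_pos z).ne'
  obtain ⟨b, hb, H⟩ := (LipschitzOnBalls.of_contDiff (hd.of_le (m := 1) (by simp))).bounded R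
  exact ⟨b, hb, fun z hz => (le_abs_self _).trans (H z hz)⟩

/-- On bounded sets of states, the input deviation is controlled by the state and the input
error. -/
theorem input_le_stateError (hs : FeedbackLinearizable f g h) (hvL : LipschitzOnBalls v)
    (hv0 : v 0 = 0) (R : ℝ) :
    ∃ C > 0, ∀ z u, ‖z‖ ≤ R →
      ‖z‖ + |u - uZero f g h| ≤ C * (‖z‖ + |stateError f g h v z u|) := by
  obtain ⟨b, hb, Hb⟩ := betaFn_inv_bounded hs R
  have hφ : ContDiff ℝ ∞ fun z => alphaFn f h z + betaFn f g h z * uZero f g h := by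
    have h1 := hs.alphaFn_contDiff
    have h2 := hs.betaFn_contDiff
    fun_prop
  obtain ⟨L, hL, HL⟩ := LipschitzOnBalls.of_contDiff (hφ.of_le (m := 1) (by simp)) |R|
  obtain ⟨Lv, hLv, Hv⟩ := hvL |R|
  refine ⟨1 + b * (L + Lv + 1), by positivity, fun z u hz => ?_⟩
  have hzR := hz.trans (le_abs_self R)
  have h1 := HL z 0 hzR (by simp)
  have h2 := Hv z 0 hzR (by simp)
  beta_reduce at h1
  rw [hs.alphaFn_add_uZero, sub_zero, sub_zero, Real.norm_eq_abs] at h1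
  rw [hv0, sub_zero, sub_zero, Real.norm_eq_abs] at h2
  have hβ := hs.betaFn_pos z
  set e := stateError f g h v z u with he
  -- The definition of `e` is solved for `u`; `v` and `α + β u₀` both vanish at the origin and are
  -- therefore `O(‖z‖)`.
  have h3 : u - uZero f g h = (betaFn f g h z)⁻¹ *
      (v z - e - (alphaFn f h z + betaFn f g h z * uZero f g h)) := by
    rw [he, stateError]
    field_simp
    ring
  have h4 : |v z - e - (alphaFn f h z + betaFn f g h z * uZero f g h)|
      ≤ Lv * ‖z‖ + |e| + L * ‖z‖ := by
    have := abs_sub (v z - e) (alphaFn f h z + betaFn f g h z * uZero f g h)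
    have := abs_sub (v z) e
    linarith
  have h5 : |u - uZero f g h| ≤ b * (Lv * ‖z‖ + |e| + L * ‖z‖) := by
    rw [h3, abs_mul, abs_of_pos (inv_pos.2 hβ)]
    gcongr
    exact Hb z hz
  have p : 0 ≤ b * (L + Lv) * |e| := by positivity
  have p' : 0 ≤ b * ‖z‖ := by positivity
  have p'' := abs_nonneg e
  linarith

/-- Solutions exist for a time that is uniform over bounded sets of states and inputs. -/
theorem exists_solution (hs : FeedbackLinearizable f g h) (R U : ℝ) :
    ∃ T₀ > 0, ∀ T, 0 < T → T ≤ T₀ → ∀ (a : ℝ) (x₀ : Sp n) (u : ℝ), ‖Psi f h x₀‖ ≤ R → |u| ≤ U →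
      ∃ y : ℝ → Sp n, y a = x₀ ∧ ∀ t ∈ Icc a (a + T),
        HasDerivWithinAt y (f (y t) + u • g (y t)) (Icc a (a + T)) t := by
  obtain ⟨b, hb, Hb⟩ := (LipschitzOnBalls.of_contDiff
    (hs.smooth_inv.of_le (m := 1) (by simp))).bounded R
  have hF : ContDiff ℝ ∞ fun p : Sp n × ℝ => f p.1 + p.2 • g p.1 := by
    have h1 := hs.smooth_f
    have h2 := hs.smooth_g
    fun_prop
  have hFL := LipschitzOnBalls.of_contDiff (hF.of_le (m := 1) (by simp))
  obtain ⟨K, hK, HK⟩ := hFL (max (b + 1) U)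
  obtain ⟨M, hM, HM⟩ := hFL.bounded (max (b + 1) U)
  -- `M` bounds the field on the unit ball around any admissible `x₀`, so a solution cannot leave
  -- that ball before time `1 / M`.
  refine ⟨1 / M, by positivity, fun T hT hTT a x₀ u hx₀ hu => ?_⟩
  have hx₀b : ‖x₀‖ ≤ b := by
    have := Hb _ hx₀
    rwa [hs.psiInv_psi] at this
  have hball : ∀ y ∈ Metric.closedBall x₀ ((1 : NNReal) : ℝ), ‖(y, u)‖ ≤ max (b + 1) U := by
    intro y hy
    rw [Metric.mem_closedBall, dist_eq_norm] at hy
    rw [Prod.norm_mk]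
    refine max_le_max ?_ hu
    have := norm_le_norm_add_norm_sub' y x₀
    push_cast at hy
    linarith
  have hPL : IsPicardLindelof (fun _ y => f y + u • g y) (tmin := a) (tmax := a + T)
      ⟨a, ⟨le_rfl, by linarith⟩⟩ x₀ 1 0 ⟨M, hM.le⟩ ⟨K, hK.le⟩ := by
    refine IsPicardLindelof.of_time_independent (fun y hy => HM (y, u) (hball y hy)) ?_ ?_
    · refine LipschitzOnWith.of_dist_le_mul fun y hy y' hy' => ?_
      rw [dist_eq_norm, dist_eq_norm]
      have := HK (y, u) (y', u) (hball y hy) (hball y' hy')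
      rwa [Prod.mk_sub_mk, sub_self, Prod.norm_mk, norm_zero, max_eq_left (norm_nonneg _)] at this
    · rw [le_div_iff₀ hM] at hTT
      change M * max (a + T - a) (a - a) ≤ ((1 : NNReal) : ℝ) - ((0 : NNReal) : ℝ)
      rw [add_sub_cancel_left, sub_self, max_eq_left hT.le]
      push_cast
      linarith
  exact hPL.exists_eq_forall_mem_Icc_hasDerivWithinAt₀

end Steps

/-! ### The invariant region, the gain bound and the gluing of trajectories. -/

section Loop

variable {n : ℕ} {f g : Sp n → Sp n} {h v : Sp n → ℝ} {P : Matrix (Fin n) (Fin n) ℝ} {lam : ℝ}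

/-- A region of states and inputs that captures the transient started in `S` and a sublevel set
of the composite function. -/
structure LoopRegion (f g : Sp n → Sp n) (h v : Sp n → ℝ) (P : Matrix (Fin n) (Fin n) ℝ)
    (N : ℕ) (ustar : ℕ → ℝ) (S : Set (Sp n)) (R₀ R U l : ℝ) : Prop where
  nonneg : 0 ≤ R₀
  radius_le : R₀ + 1 ≤ R
  initial : ∀ x ∈ S, ‖Psi f h x‖ ≤ R₀
  input_le : ∀ k ≤ N, |ustar k| ≤ U
  level : ∀ z, ‖z‖ ≤ R₀ + 1 → compositeV f g h v P z (ustar N) ≤ l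
  sublevel : ∀ z u, compositeV f g h v P z u ≤ l → ‖z‖ ≤ R ∧ |u| ≤ U

/-- The level `l` bounds `V_z + e²` over all states reachable at the end of the transient. On its
sublevel set positive definiteness bounds `z`, and `input_le_stateError` then bounds `u`. Nothing
here depends on `γ`, so the gain bound may be read off from `R` afterwards. -/
theorem exists_loopRegion (hs : FeedbackLinearizable f g h) (hP : P.PosDef)
    (hvL : LipschitzOnBalls v) (hv0 : v 0 = 0) (N : ℕ) (ustar : ℕ → ℝ) {S : Set (Sp n)}
    (hS : IsCompact S) : ∃ R₀ R U l : ℝ, LoopRegion f g h v P N ustar S R₀ R U l := by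
  obtain ⟨R₀', hR₀'⟩ := hS.exists_bound_of_continuousOn hs.psi_contDiff.continuous.continuousOn
  set R₀ := |R₀'|
  obtain ⟨m, hm, hmV⟩ := exists_le_quadV hP
  obtain ⟨ba, hba, Ba⟩ := hs.alphaFn_lipschitz.bounded (R₀ + 1)
  obtain ⟨bb, hbb, Bb⟩ := hs.betaFn_lipschitz.bounded (R₀ + 1)
  obtain ⟨bv, hbv, Bv⟩ := hvL.bounded (R₀ + 1)
  set e₀ := bv + (ba + bb * |ustar N|) with he₀
  have he₀0 : 0 < e₀ := by positivity
  set l := ‖Matrix.toEuclideanCLM (𝕜 := ℝ) P‖ * (R₀ + 1) ^ 2 + e₀ ^ 2 with hl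
  have hl0 : 0 ≤ l := by positivity
  set R := max (R₀ + 1) (Real.sqrt (l / m))
  obtain ⟨C, hC, HC⟩ := input_le_stateError hs hvL hv0 R
  have hU0 : ∀ k ≤ N, |ustar k| ≤ ∑ k ∈ Finset.range (N + 1), |ustar k| := fun k hk =>
    Finset.single_le_sum (f := fun k => |ustar k|) (fun _ _ => abs_nonneg _)
      (Finset.mem_range.2 (by omega))
  refine ⟨R₀, R, max (∑ k ∈ Finset.range (N + 1), |ustar k|)
    (|uZero f g h| + C * (R + Real.sqrt l)), l, abs_nonneg _, le_max_left _ _,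
    fun x hx => (hR₀' x hx).trans (le_abs_self _), fun k hk => (hU0 k hk).trans (le_max_left _ _),
    fun z hz => ?_, fun z u hzu => ?_⟩
  · have he : |stateError f g h v z (ustar N)| ≤ e₀ := by
      have h1 := Bv z hz
      have h2 := Ba z hz
      have h3 := Bb z hz
      rw [Real.norm_eq_abs] at h1 h2 h3
      have h4 : |betaFn f g h z * ustar N| ≤ bb * |ustar N| := by rw [abs_mul]; gcongr
      have h5 := abs_add_le (alphaFn f h z) (betaFn f g h z * ustar N)
      have h6 := abs_sub (v z) (alphaFn f h z + betaFn f g h z * ustar N)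
      rw [stateError, he₀]
      linarith
    unfold compositeV
    refine add_le_add ((quadV_le P z).trans ?_) ?_
    · gcongr
    · rw [← sq_abs]; gcongr
  · unfold compositeV at hzu
    have h1 := hmV z
    have h0 : 0 ≤ m * ‖z‖ ^ 2 := by positivity
    have hz : ‖z‖ ≤ R := by
      refine (Real.le_sqrt_of_sq_le ?_).trans (le_max_right _ _)
      rw [le_div_iff₀ hm]
      linarith [sq_nonneg (stateError f g h v z u)]
    have he : |stateError f g h v z u| ≤ Real.sqrt l := Real.abs_le_sqrt (by linarith)
    refine ⟨hz, le_trans ?_ (le_max_right _ _)⟩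
    have h2 := HC z u hz
    have h3 : C * (‖z‖ + |stateError f g h v z u|) ≤ C * (R + Real.sqrt l) := by gcongr
    have h4 := abs_add_le (uZero f g h) (u - uZero f g h)
    rw [add_sub_cancel] at h4
    linarith [norm_nonneg z]

/-- A bound on the controller gain that makes the input error contract on a ball. -/
theorem exists_gain (hs : FeedbackLinearizable f g h) {R : ℝ} (hR : 0 ≤ R) :
    ∃ γs > 0, (∀ βbar : ℝ, (∀ z, betaFn f g h z ≤ βbar) → βbar⁻¹ ≤ γs) ∧
      ∀ γ, 0 < γ → γ < γs → ∃ ρ, 0 ≤ ρ ∧ ρ < 1 ∧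
        ∀ z, ‖z‖ ≤ R → 0 ≤ 1 - γ * betaFn f g h z ∧ 1 - γ * betaFn f g h z ≤ ρ := by
  obtain ⟨z₀, -, hmax⟩ := (isCompact_closedBall (0 : Sp n) R).exists_isMaxOn
    ⟨0, by simpa using hR⟩ hs.betaFn_contDiff.continuous.continuousOn
  have hpos := hs.betaFn_pos z₀
  obtain ⟨b, hb, Hb⟩ := betaFn_inv_bounded hs R
  -- The bound is the inverse of the maximum of `β` on the ball; a global upper bound of `β` is at
  -- least this maximum. The rate is `ρ = 1 - γ / b`, with `1 / b` a lower bound of `β` there.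
  refine ⟨(betaFn f g h z₀)⁻¹, inv_pos.2 hpos, fun βbar H => inv_anti₀ hpos (H z₀),
    fun γ hγ hγs => ?_⟩
  have key : ∀ z, ‖z‖ ≤ R →
      0 ≤ 1 - γ * betaFn f g h z ∧ 1 - γ * betaFn f g h z ≤ 1 - γ * b⁻¹ := by
    intro z hz
    have h1 : betaFn f g h z ≤ betaFn f g h z₀ := hmax (by simpa using hz)
    have h2 : b⁻¹ ≤ betaFn f g h z := by
      have := inv_anti₀ (inv_pos.2 (hs.betaFn_pos z)) (Hb z hz)
      rwa [inv_inv] at this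
    have h3 : γ * betaFn f g h z ≤ (betaFn f g h z₀)⁻¹ * betaFn f g h z₀ :=
      mul_le_mul hγs.le h1 (hs.betaFn_pos z).le (inv_pos.2 hpos).le
    rw [inv_mul_cancel₀ hpos.ne'] at h3
    have h4 : γ * b⁻¹ ≤ γ * betaFn f g h z := by gcongr
    constructor <;> linarith
  have h0 := key 0 (by simpa using hR)
  refine ⟨1 - γ * b⁻¹, h0.1.trans h0.2, ?_, key⟩
  have : 0 < γ * b⁻¹ := by positivity
  linarith

/-- `(x, u)` obeys the closed loop up to time `KT`, the input `u(K)` that starts to act at that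
time included. -/
structure LoopThrough (f g : Sp n → Sp n) (h v : Sp n → ℝ) (est : Estimator n)
    (γ : ℝ) (N : ℕ) (ustar : ℕ → ℝ) (T : ℝ) (K : ℕ) (x : ℝ → Sp n) (u : ℕ → ℝ) : Prop where
  ode : ∀ k < K, ∀ t ∈ Icc ((k : ℝ) * T) (((k : ℝ) + 1) * T),
    HasDerivWithinAt x (f (x t) + u k • g (x t))
      (Icc ((k : ℝ) * T) (((k : ℝ) + 1) * T)) t
  transient : ∀ k ≤ K, k ≤ N → u k = ustar k
  control : ∀ k, N ≤ k → k + 1 ≤ K →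
    u (k + 1) = u k + γ * (v (est T (h ∘ x) u k).1 - (est T (h ∘ x) u k).2)

section

variable {est : Estimator n} {γ : ℝ} {N : ℕ} {ustar : ℕ → ℝ} {T : ℝ} {K : ℕ}
  {x x' : ℝ → Sp n} {u u' : ℕ → ℝ}

theorem LoopThrough.mono {L : ℕ} (hx : LoopThrough f g h v est γ N ustar T K x u) (hL : L ≤ K) :
    LoopThrough f g h v est γ N ustar T L x u where
  ode k hk := hx.ode k (hk.trans_le hL)
  transient k hk := hx.transient k (hk.trans hL)
  control k hN hk := hx.control k hN (hk.trans hL)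

theorem LoopThrough.closedLoopUpTo (hx : LoopThrough f g h v est γ N ustar T K x u) :
    ClosedLoopUpTo f g h v est γ N ustar T K x u where
  ode := hx.ode
  transient k hk := hx.transient k hk.le
  control k hN hk := hx.control k hN hk.le

/-- `ClosedLoopUpTo` at `K` leaves `u K` free, while `V_z + e²` at the sample `K` involves it; the
two notions differ by this shift of one index. -/
theorem closedLoop_iff :
    ClosedLoop f g h v est γ N ustar T x u ↔
      ∀ K, LoopThrough f g h v est γ N ustar T K x u := by
  refine ⟨fun H K => ⟨(H K).ode, fun k hk => (H (K + 1)).transient k (by omega),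
    fun k hN hk => (H (K + 1)).control k hN (by omega)⟩, fun H K => (H K).closedLoopUpTo⟩

theorem sample_le {k : ℕ} (hT : 0 < T) (hk : k < K) {t : ℝ}
    (ht : t ∈ Icc ((k : ℝ) * T) (((k : ℝ) + 1) * T)) : t ∈ Icc 0 ((K : ℝ) * T) := by
  have h1 : ((k : ℝ) + 1) ≤ K := by exact_mod_cast hk
  refine ⟨le_trans (by positivity) ht.1, ht.2.trans (by gcongr)⟩

/-- The inputs up to `u K` use only estimates of index below `K`, which by causality see the output
on `[0, KT]` alone. -/
theorem LoopThrough.congr (hest : est.IsCausal) (hT : 0 < T)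
    (hx : LoopThrough f g h v est γ N ustar T K x u)
    (hxx : ∀ t ∈ Icc 0 ((K : ℝ) * T), x' t = x t) (huu : ∀ k ≤ K, u' k = u k) :
    LoopThrough f g h v est γ N ustar T K x' u' where
  ode k hk t ht := by
    rw [hxx t (sample_le hT hk ht), huu k hk.le]
    exact (hx.ode k hk t ht).congr (fun s hs => hxx s (sample_le hT hk hs))
      (hxx t (sample_le hT hk ht))
  transient k hk hN := by rw [huu k hk, hx.transient k hk hN]
  control k hN hk := by
    have : est T (h ∘ x') u' k = est T (h ∘ x) u k := by
      refine hest T hT _ _ _ _ k (fun t ht => ?_) (fun j hj => huu j (by omega))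
      have h1 : ((k : ℝ) + 1) ≤ K := by exact_mod_cast hk
      exact congrArg h (hxx t ⟨ht.1, ht.2.trans (by gcongr)⟩)
    rw [huu _ hk, huu k (by omega), hx.control k hN hk, this]

/-- A trajectory can be continued over one more sampling period. -/
theorem LoopThrough.extend (hest : est.IsCausal) (hT : 0 < T)
    (hx : LoopThrough f g h v est γ N ustar T K x u) {y : ℝ → Sp n}
    (hy₀ : y ((K : ℝ) * T) = x ((K : ℝ) * T))
    (hy : ∀ t ∈ Icc ((K : ℝ) * T) ((K : ℝ) * T + T),
      HasDerivWithinAt y (f (y t) + u K • g (y t)) (Icc ((K : ℝ) * T) ((K : ℝ) * T + T)) t) :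
    ∃ x' u', LoopThrough f g h v est γ N ustar T (K + 1) x' u' ∧
      (∀ t ∈ Icc 0 ((K : ℝ) * T), x' t = x t) ∧ ∀ k ≤ K, u' k = u k := by
  set x' : ℝ → Sp n := fun t => if t ≤ (K : ℝ) * T then x t else y t with hx'
  -- The new input is computed from the old sequence `u`, which avoids a circular definition;
  -- causality identifies that estimate with the one from `u'`. Values beyond `K + 1` are
  -- irrelevant.
  set u' : ℕ → ℝ := fun k => if k ≤ K then u k else if k ≤ N then ustar k else
    u K + γ * (v (est T (h ∘ x') u K).1 - (est T (h ∘ x') u K).2) with hu'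
  have hxx : ∀ t ∈ Icc 0 ((K : ℝ) * T), x' t = x t := fun t ht => if_pos ht.2
  have huu : ∀ k ≤ K, u' k = u k := fun k hk => if_pos hk
  have hxy : ∀ t ∈ Icc ((K : ℝ) * T) ((K : ℝ) * T + T), x' t = y t := by
    intro t ht
    rcases ht.1.eq_or_lt with heq | hlt
    · rw [← heq, hy₀]; exact if_pos le_rfl
    · exact if_neg hlt.not_ge
  have hc := hx.congr hest hT hxx huu
  refine ⟨x', u', ⟨fun k hk t ht => ?_, fun k hk hN => ?_, fun k hN hk => ?_⟩, hxx, huu⟩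
  · rcases Nat.lt_succ_iff_lt_or_eq.1 hk with hk | rfl
    · exact hc.ode k hk t ht
    · rw [add_one_mul] at ht ⊢
      rw [hxy t ht, huu k le_rfl]
      exact (hy t ht).congr hxy (hxy t ht)
  · rcases Nat.le_succ_iff.1 hk with hk | rfl
    · exact hc.transient k hk hN
    · have : ¬ K + 1 ≤ K := by omega
      simp only [hu', this, if_false]
      exact if_pos hN
  · rcases Nat.le_succ_iff.1 hk with hk | hk
    · exact hc.control k hN hk
    · obtain rfl : k = K := by omega
      have h1 : est T (h ∘ x') u' k = est T (h ∘ x') u k :=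
        hest T hT _ _ _ _ k (fun _ _ => rfl) huu
      have h2 : ¬ k + 1 ≤ k := by omega
      have h3 : ¬ k + 1 ≤ N := by omega
      rw [h1, huu k le_rfl]
      change (if k + 1 ≤ k then _ else if k + 1 ≤ N then _ else _) = _
      rw [if_neg h2, if_neg h3]

/-- If finite trajectories can always be continued, there is a trajectory on `[0, ∞)`. -/
theorem exists_closedLoop (hest : est.IsCausal) (hT : 0 < T) (x₀ : Sp n)
    (hsol : ∀ (K : ℕ) (x : ℝ → Sp n) (u : ℕ → ℝ), LoopThrough f g h v est γ N ustar T K x u →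
      x 0 = x₀ → ∃ y : ℝ → Sp n, y ((K : ℝ) * T) = x ((K : ℝ) * T) ∧
        ∀ t ∈ Icc ((K : ℝ) * T) ((K : ℝ) * T + T),
          HasDerivWithinAt y (f (y t) + u K • g (y t))
            (Icc ((K : ℝ) * T) ((K : ℝ) * T + T)) t) :
    ∃ x u, ClosedLoop f g h v est γ N ustar T x u ∧ x 0 = x₀ := by
  -- The hypothesis on `p` is placed under the existential so that choice yields a total function,
  -- to be iterated.
  have step : ∀ (K : ℕ) (p : (ℝ → Sp n) × (ℕ → ℝ)), ∃ p' : (ℝ → Sp n) × (ℕ → ℝ),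
      LoopThrough f g h v est γ N ustar T K p.1 p.2 ∧ p.1 0 = x₀ →
      (LoopThrough f g h v est γ N ustar T (K + 1) p'.1 p'.2 ∧ p'.1 0 = x₀) ∧
      (∀ t ∈ Icc 0 ((K : ℝ) * T), p'.1 t = p.1 t) ∧ ∀ k ≤ K, p'.2 k = p.2 k := by
    intro K p
    by_cases hp : LoopThrough f g h v est γ N ustar T K p.1 p.2 ∧ p.1 0 = x₀
    · obtain ⟨y, hy₀, hy⟩ := hsol K p.1 p.2 hp.1 hp.2
      obtain ⟨x', u', h1, h2, h3⟩ := hp.1.extend hest hT hy₀ hy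
      refine ⟨(x', u'), fun _ => ⟨⟨h1, ?_⟩, h2, h3⟩⟩
      exact (h2 0 ⟨le_rfl, by positivity⟩).trans hp.2
    · exact ⟨p, fun hp' => absurd hp' hp⟩
  choose F hF using step
  set s : ℕ → (ℝ → Sp n) × (ℕ → ℝ) := fun K => Nat.rec (fun _ => x₀, ustar) F K with hs_def
  have hs : ∀ K, LoopThrough f g h v est γ N ustar T K (s K).1 (s K).2 ∧ (s K).1 0 = x₀ := by
    intro K
    induction K with
    | zero =>
      exact ⟨⟨fun k hk => absurd hk (by omega), fun _ _ _ => rfl,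
        fun k _ hk => absurd hk (by omega)⟩, rfl⟩
    | succ K ih => exact (hF K (s K) ih).1
  have hagree : ∀ K L : ℕ, K ≤ L → (∀ t ∈ Icc 0 ((K : ℝ) * T), (s L).1 t = (s K).1 t) ∧
      ∀ k ≤ K, (s L).2 k = (s K).2 k := by
    intro K L hKL
    induction L, hKL using Nat.le_induction with
    | base => exact ⟨fun _ _ => rfl, fun _ _ => rfl⟩
    | succ L hKL ih =>
      obtain ⟨-, h1, h2⟩ := hF L (s L) (hs L)
      have hKL' : (K : ℝ) ≤ L := by exact_mod_cast hKL
      exact ⟨fun t ht => (h1 t ⟨ht.1, ht.2.trans (by gcongr)⟩).trans (ih.1 t ht),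
        fun k hk => (h2 k (hk.trans hKL)).trans (ih.2 k hk)⟩
  -- At time `t` the approximation of index `⌈t / T⌉` is already final, since `t ≤ ⌈t / T⌉ T`;
  -- likewise `u k` is final from index `k` on.
  refine ⟨fun t => (s ⌈t / T⌉₊).1 t, fun k => (s k).2 k, closedLoop_iff.2 fun K => ?_, ?_⟩
  · refine (hs K).1.congr hest hT (fun t ht => ?_) (fun k hk => ((hagree k K hk).2 k le_rfl).symm)
    have h1 : ⌈t / T⌉₊ ≤ K := Nat.ceil_le.2 ((div_le_iff₀ hT).2 ht.2)
    refine ((hagree _ _ h1).1 t ⟨ht.1, ?_⟩).symm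
    rw [← div_le_iff₀ hT]
    exact Nat.le_ceil _
  · exact (hs _).2

end

end Loop

/-! ### Invariance, convergence and uniform bounds. -/

section Bounds

variable {n : ℕ} {f g : Sp n → Sp n} {h v : Sp n → ℝ} {P : Matrix (Fin n) (Fin n) ℝ} {lam : ℝ}

/-- The bounds obeyed by closed-loop trajectories up to the sampling instant `KT`: they stay in
the region, the intersample deviation and the estimation error are of order `T`, and the
composite function contracts. -/
structure LoopBounds (f g : Sp n → Sp n) (h v : Sp n → ℝ) (P : Matrix (Fin n) (Fin n) ℝ)
    (est : Estimator n) (N : ℕ) (R₀ R U l C M κ T : ℝ) (K : ℕ) (x : ℝ → Sp n) (u : ℕ → ℝ) :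
    Prop where
  box : ∀ k ≤ K, ‖zAt f h T x k‖ ≤ R ∧ |u k| ≤ U
  early : ∀ k ≤ K, k ≤ N → ‖zAt f h T x k‖ ≤ R₀ + k / (N + 1)
  level : ∀ k ≤ K, N ≤ k → compositeV f g h v P (zAt f h T x k) (u k) ≤ l
  intersample : ∀ k < K, ∀ t ∈ Icc ((k : ℝ) * T) (((k : ℝ) + 1) * T),
    ‖Psi f h (x t) - zAt f h T x k‖ ≤ C * T * (‖zAt f h T x k‖ + |u k - uZero f g h|) ∧
    ‖Psi f h (x t) - zAt f h T x k‖ ≤ 1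
  estimate : ∀ k < K, N ≤ k → pairNorm (zAt f h T x k - (est T (h ∘ x) u k).1)
    (zExtra f g h T x u k - (est T (h ∘ x) u k).2)
      ≤ M * T * (‖zAt f h T x k‖ + |u k - uZero f g h|)
  contract : ∀ k < K, N ≤ k → compositeV f g h v P (zAt f h T x (k + 1)) (u (k + 1))
    ≤ (1 - κ * T) * compositeV f g h v P (zAt f h T x k) (u k)

theorem early_bound {R₀ : ℝ} {k N : ℕ} (hk : k ≤ N) : R₀ + k / (N + 1) ≤ R₀ + 1 := by
  gcongr
  rw [div_le_one (by positivity)]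
  have : (k : ℝ) ≤ N := by exact_mod_cast hk
  linarith

/-- The one-step estimates hold only inside the region, and their conclusion puts the next sample
back into it, so the induction on `K` closes with constants chosen once. During the transient
nothing contracts, but each period moves `z` by at most `1 / (N + 1)`. -/
theorem exists_loopBounds (hs : FeedbackLinearizable f g h) (hP : P.PosDef) (hlam : 0 < lam)
    (hv : LyapunovDecrease f g h v P lam) (hvL : LipschitzOnBalls v) (hv0 : v 0 = 0)
    {N : ℕ} {ustar : ℕ → ℝ} {S : Set (Sp n)} {R₀ R U l : ℝ}
    (hreg : LoopRegion f g h v P N ustar S R₀ R U l) {γ ρ : ℝ} (hγ : 0 < γ) (hρ₀ : 0 ≤ ρ)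
    (hρ : ρ < 1)
    (hgain : ∀ z, ‖z‖ ≤ R → 0 ≤ 1 - γ * betaFn f g h z ∧ 1 - γ * betaFn f g h z ≤ ρ)
    {est : Estimator n} (herr : EstimationError f g h v est γ N ustar) :
    ∃ C > 0, ∃ M > 0, ∃ κ > 0, ∃ T₀ > 0, ∀ T, 0 < T → T ≤ T₀ → κ * T ≤ 1 ∧
      ∀ (K : ℕ) (x : ℝ → Sp n) (u : ℕ → ℝ), LoopThrough f g h v est γ N ustar T K x u →
        x 0 ∈ S → LoopBounds f g h v P est N R₀ R U l C M κ T K x u := by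
  obtain ⟨C, hC, T₁, hT₁, hstep⟩ := quadV_step hs hP hv R U
  -- The radius is `R + 1` because the estimator's error bound requires the whole trajectory,
  -- intersample values included, to stay in the compact set.
  obtain ⟨M, hM, T₂, hT₂, hest⟩ := herr (Metric.closedBall 0 (R + 1) ×ˢ Icc (-U) U)
    ((isCompact_closedBall 0 (R + 1)).prod isCompact_Icc)
  obtain ⟨Ce, hCe, T₃, hT₃, herrstep⟩ := stateError_step hs hvL R U
    (M := max C M) (γ := γ) (by positivity) hγ
  obtain ⟨Cb, hCb, hinput⟩ := input_le_stateError hs hvL hv0 R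
  set Cm := max C (max Ce Cb) with hCm
  obtain ⟨κ, hκ, T₄, hT₄, hcontr⟩ := composite_contraction
    (m := ‖Matrix.toEuclideanCLM (𝕜 := ℝ) P‖ + 1) (C := Cm) (c := 1) (by positivity) hlam
    (by positivity) one_pos hρ₀ hρ
  set q₀ := |R| + |U| + |uZero f g h| + 1 with hq₀
  refine ⟨C, hC, M, hM, κ, hκ, min (min T₁ T₂) (min (min T₃ T₄) (1 / (C * q₀ * (N + 1)))),
    by positivity, ?_⟩
  intro T hT hTT
  simp only [le_min_iff] at hTT
  obtain ⟨⟨hTT₁, hTT₂⟩, ⟨hTT₃, hTT₄⟩, hTT₅⟩ := hTT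
  obtain ⟨hκT, hcontr⟩ := hcontr T hT hTT₄
  refine ⟨hκT, fun K => ?_⟩
  have hsmall : ∀ q, q ≤ q₀ → C * T * q ≤ 1 / (N + 1) := by
    intro q hq
    rw [le_div_iff₀ (by positivity)] at hTT₅ ⊢
    calc C * T * q * (N + 1) ≤ C * T * q₀ * (N + 1) := by gcongr
      _ ≤ 1 := by linarith
  have hN1 : (1 : ℝ) / (N + 1) ≤ 1 := by
    rw [div_le_one (by positivity)]
    linarith [(Nat.cast_nonneg N : (0 : ℝ) ≤ N)]
  have hCmC : C ≤ Cm := le_max_left _ _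
  have hCmCe : Ce ≤ Cm := (le_max_left _ _).trans (le_max_right _ _)
  have hCmCb : Cb ≤ Cm := (le_max_right _ _).trans (le_max_right _ _)
  induction K with
  | zero =>
    intro x u hx hxS
    have h0 : zAt f h T x 0 = Psi f h (x 0) := by simp [zAt]
    have hz0 : ‖zAt f h T x 0‖ ≤ R₀ := by rw [h0]; exact hreg.initial _ hxS
    refine ⟨fun k hk => ?_, fun k hk hN => ?_, fun k hk hN => ?_, fun k hk => absurd hk (by omega),
      fun k hk => absurd hk (by omega), fun k hk => absurd hk (by omega)⟩
    · obtain rfl : k = 0 := by omega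
      refine ⟨hz0.trans (by linarith [hreg.radius_le]), ?_⟩
      rw [hx.transient 0 hk (by omega)]
      exact hreg.input_le 0 (by omega)
    · obtain rfl : k = 0 := by omega
      simpa using hz0
    · obtain rfl : k = 0 := by omega
      obtain rfl : N = 0 := by omega
      rw [hx.transient 0 le_rfl le_rfl]
      exact hreg.level _ (by linarith)
  | succ K ih =>
    intro x u hx hxS
    have IH := ih x u (hx.mono (Nat.le_succ K)) hxS
    obtain ⟨hzK, huK⟩ := IH.box K le_rfl
    have hode := hx.ode K (Nat.lt_succ_self K)
    rw [add_one_mul] at hode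
    obtain ⟨hint, hV⟩ := hstep T hT hTT₁ ((K : ℝ) * T) x (u K) huK hzK hode
    have hnext : Psi f h (x ((K : ℝ) * T + T)) = zAt f h T x (K + 1) := by
      rw [zAt]; push_cast; rw [add_one_mul]
    have hdev := hint ((K : ℝ) * T + T) ⟨by linarith, le_rfl⟩
    rw [hnext] at hV hdev
    change ∀ t ∈ _, ‖Psi f h (x t) - zAt f h T x K‖
      ≤ C * T * (‖zAt f h T x K‖ + |u K - uZero f g h|) at hint
    change _ ≤ quadV P (zAt f h T x K) - lam * T * ‖zAt f h T x K‖ ^ 2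
      + C * T * |stateError f g h v (zAt f h T x K) (u K)| * ‖zAt f h T x K‖
      + C * T ^ 2 * (‖zAt f h T x K‖ + |u K - uZero f g h|) ^ 2 at hV
    change ‖zAt f h T x (K + 1) - zAt f h T x K‖
      ≤ C * T * (‖zAt f h T x K‖ + |u K - uZero f g h|) at hdev
    have hqK : ‖zAt f h T x K‖ + |u K - uZero f g h| ≤ q₀ := by
      have := abs_sub (u K) (uZero f g h)
      rw [hq₀]
      linarith [le_abs_self R, le_abs_self U]
    have hsm := hsmall _ hqK
    have hinter : ∀ k < K + 1, ∀ t ∈ Icc ((k : ℝ) * T) (((k : ℝ) + 1) * T),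
        ‖Psi f h (x t) - zAt f h T x k‖ ≤ C * T * (‖zAt f h T x k‖ + |u k - uZero f g h|) ∧
        ‖Psi f h (x t) - zAt f h T x k‖ ≤ 1 := by
      intro k hk t ht
      rcases Nat.lt_succ_iff_lt_or_eq.1 hk with hk | rfl
      · exact IH.intersample k hk t ht
      · rw [add_one_mul] at ht
        exact ⟨hint t ht, (hint t ht).trans (hsm.trans hN1)⟩
    have hestK : N ≤ K → pairNorm (zAt f h T x K - (est T (h ∘ x) u K).1)
        (zExtra f g h T x u K - (est T (h ∘ x) u K).2)
          ≤ M * T * (‖zAt f h T x K‖ + |u K - uZero f g h|) := by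
      intro hN
      refine (hest T hT hTT₂ K hN x u hx.closedLoopUpTo fun j hj t ht => ⟨?_, ?_⟩).trans ?_
      · have h1 := (hinter j (by omega) t ht).2
        have h2 := (IH.box j hj).1
        have h3 := norm_le_norm_add_norm_sub' (Psi f h (x t)) (zAt f h T x j)
        rw [mem_closedBall_zero_iff]
        change ‖Psi f h (x t)‖ ≤ R + 1
        linarith
      · exact abs_le.1 (IH.box j hj).2
      · gcongr
        exact pairNorm_le _ _
    have hcontrK : N ≤ K → compositeV f g h v P (zAt f h T x (K + 1)) (u (K + 1))
        ≤ (1 - κ * T) * compositeV f g h v P (zAt f h T x K) (u K) := by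
      intro hN
      have he := hestK hN
      have hmax1 : C * T * (‖zAt f h T x K‖ + |u K - uZero f g h|)
          ≤ max C M * T * (‖zAt f h T x K‖ + |u K - uZero f g h|) := by
        gcongr; exact le_max_left _ _
      have hmax2 : M * T * (‖zAt f h T x K‖ + |u K - uZero f g h|)
          ≤ max C M * T * (‖zAt f h T x K‖ + |u K - uZero f g h|) := by
        gcongr; exact le_max_right _ _
      have hE := herrstep T hT hTT₃ (zAt f h T x K) (zAt f h T x (K + 1))
        (est T (h ∘ x) u K).1 (u K) (est T (h ∘ x) u K).2 huK hzK (hdev.trans hmax1)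
        ((norm_le_pairNorm _ _).trans (he.trans hmax2))
        ((abs_le_pairNorm _ _).trans (he.trans hmax2))
      rw [← hx.control K hN le_rfl] at hE
      obtain ⟨hr0, hrρ⟩ := hgain _ hzK
      have hin := hinput (zAt f h T x K) (u K) hzK
      have := hcontr ‖zAt f h T x K‖ (quadV P (zAt f h T x K)) (quadV P (zAt f h T x (K + 1)))
        (stateError f g h v (zAt f h T x K) (u K))
        (stateError f g h v (zAt f h T x (K + 1)) (u (K + 1)))
        (‖zAt f h T x K‖ + |u K - uZero f g h|) (1 - γ * betaFn f g h (zAt f h T x K))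
        (norm_nonneg _) (by positivity) ((quadV_le P _).trans (by gcongr; linarith))
        (hin.trans (by gcongr)) hr0 hrρ (hV.trans (by gcongr)) (hE.trans (by gcongr))
      simpa only [one_mul, compositeV] using this
    have hearly : K + 1 ≤ N → ‖zAt f h T x (K + 1)‖ ≤ R₀ + ((K + 1 : ℕ) : ℝ) / (N + 1) := by
      intro hN
      have h1 := IH.early K le_rfl (by omega)
      have h2 := norm_le_norm_add_norm_sub' (zAt f h T x (K + 1)) (zAt f h T x K)
      have h3 : ((K + 1 : ℕ) : ℝ) / (N + 1) = K / (N + 1) + 1 / (N + 1) := by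
        push_cast; rw [add_div]
      linarith
    have hlevel : N ≤ K + 1 → compositeV f g h v P (zAt f h T x (K + 1)) (u (K + 1)) ≤ l := by
      intro hN
      -- At index `N` the level comes from the end of the transient; later it is inherited through
      -- the contraction.
      rcases hN.eq_or_lt with heq | hlt
      · rw [hx.transient (K + 1) le_rfl heq.ge, ← heq]
        refine hreg.level _ ?_
        rw [heq]
        exact (hearly heq.ge).trans (early_bound heq.ge)
      · have hN' : N ≤ K := by omega
        refine (hcontrK hN').trans (le_trans ?_ (IH.level K le_rfl hN'))
        have h0 : 0 ≤ compositeV f g h v P (zAt f h T x K) (u K) := by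
          obtain ⟨m, hm, hmV⟩ := exists_le_quadV hP
          have := hmV (zAt f h T x K)
          have h1 : 0 ≤ m * ‖zAt f h T x K‖ ^ 2 := by positivity
          exact add_nonneg (h1.trans this) (sq_nonneg _)
        have h1 : 0 < κ * T := by positivity
        nlinarith
    refine ⟨fun k hk => ?_, fun k hk hN => ?_, fun k hk hN => ?_, hinter, fun k hk hN => ?_,
      fun k hk hN => ?_⟩
    · rcases Nat.le_succ_iff.1 hk with hk | rfl
      · exact IH.box k hk
      · rcases le_total (K + 1) N with hN | hN
        · refine ⟨((hearly hN).trans (early_bound hN)).trans hreg.radius_le, ?_⟩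
          rw [hx.transient _ le_rfl hN]
          exact hreg.input_le _ hN
        · exact hreg.sublevel _ _ (hlevel hN)
    · rcases Nat.le_succ_iff.1 hk with hk | rfl
      · exact IH.early k hk hN
      · exact hearly hN
    · rcases Nat.le_succ_iff.1 hk with hk | rfl
      · exact IH.level k hk hN
      · exact hlevel hN
    · rcases Nat.lt_succ_iff_lt_or_eq.1 hk with hk | rfl
      · exact IH.estimate k hk hN
      · exact hestK hN
    · rcases Nat.lt_succ_iff_lt_or_eq.1 hk with hk | rfl
      · exact IH.contract k hk hN
      · exact hcontrK hN

variable {est : Estimator n} {N : ℕ} {R₀ R U l C M κ T : ℝ} {x : ℝ → Sp n} {u : ℕ → ℝ}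

theorem mem_sampling_interval (hT : 0 < T) {t : ℝ} (ht : 0 ≤ t) :
    t ∈ Icc ((⌊t / T⌋₊ : ℝ) * T) (((⌊t / T⌋₊ : ℝ) + 1) * T) := by
  refine ⟨?_, ?_⟩
  · rw [← le_div_iff₀ hT]
    exact Nat.floor_le (by positivity)
  · rw [← div_le_iff₀ hT]
    exact (Nat.lt_floor_add_one _).le

/-- Trajectories that obey the bounds for all times converge to the origin. -/
theorem tendsto_zero_of_loopBounds (hs : FeedbackLinearizable f g h) (hP : P.PosDef)
    (hvL : LipschitzOnBalls v) (hv0 : v 0 = 0) (hC : 0 < C) (hκ : 0 < κ) (hT : 0 < T)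
    (hκT : κ * T ≤ 1) (hb : ∀ K, LoopBounds f g h v P est N R₀ R U l C M κ T K x u) :
    Tendsto x atTop (𝓝 0) := by
  obtain ⟨m, hm, hmV⟩ := exists_le_quadV hP
  obtain ⟨Cb, hCb, hinput⟩ := input_le_stateError hs hvL hv0 R
  set W : ℕ → ℝ := fun k => compositeV f g h v P (zAt f h T x k) (u k) with hW
  have hmW : ∀ k, m * ‖zAt f h T x k‖ ^ 2 ≤ W k := fun k =>
    (hmV _).trans (le_add_of_nonneg_right (sq_nonneg _))
  have hW0 : ∀ k, 0 ≤ W k := fun k => le_trans (by positivity) (hmW k)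
  have hgeom : ∀ j, W (j + N) ≤ (1 - κ * T) ^ j * W N := by
    intro j
    induction j with
    | zero => simp
    | succ j ih =>
      have h1 := (hb (j + N + 1)).contract (j + N) (by omega) (by omega)
      rw [add_right_comm]
      refine h1.trans ?_
      rw [pow_succ', mul_assoc]
      exact mul_le_mul_of_nonneg_left ih (by linarith)
  have hWlim : Tendsto W atTop (𝓝 0) := by
    rw [← tendsto_add_atTop_iff_nat N]
    refine squeeze_zero (fun j => hW0 _) hgeom ?_
    have h1 : 0 < κ * T := by positivity
    simpa using (tendsto_pow_atTop_nhds_zero_of_lt_one (by linarith : 0 ≤ 1 - κ * T)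
      (by linarith)).mul_const (W N)
  -- `B k` bounds `Ψ(x(t))` over the whole `k`-th period: the size of the sample plus the
  -- intersample deviation, both expressed through `W k`.
  set B : ℕ → ℝ := fun k => (1 + C * T * Cb) * (Real.sqrt (W k / m) + Real.sqrt (W k)) with hB_def
  have hBlim : Tendsto B atTop (𝓝 0) := by
    have h1 := ((hWlim.div_const m).sqrt.add hWlim.sqrt).const_mul (1 + C * T * Cb)
    simpa using h1
  have hbound : ∀ t, 0 ≤ t → ‖Psi f h (x t)‖ ≤ B ⌊t / T⌋₊ := by
    intro t ht
    set k := ⌊t / T⌋₊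
    have h1 := ((hb (k + 1)).intersample k (by omega) t (mem_sampling_interval hT ht)).1
    have h2 := hinput _ (u k) ((hb k).box k le_rfl).1
    have h3 : ‖zAt f h T x k‖ ≤ Real.sqrt (W k / m) := by
      refine Real.le_sqrt_of_sq_le ?_
      rw [le_div_iff₀ hm]
      linarith [hmW k]
    have h4 : |stateError f g h v (zAt f h T x k) (u k)| ≤ Real.sqrt (W k) := by
      refine Real.abs_le_sqrt (le_add_of_nonneg_left ?_)
      exact le_trans (by positivity) (hmV _)
    have h5 := norm_le_norm_add_norm_sub' (Psi f h (x t)) (zAt f h T x k)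
    have h6 : C * T * (‖zAt f h T x k‖ + |u k - uZero f g h|)
        ≤ C * T * (Cb * (Real.sqrt (W k / m) + Real.sqrt (W k))) := by
      refine mul_le_mul_of_nonneg_left (h2.trans ?_) (by positivity)
      gcongr
    have h7 := Real.sqrt_nonneg (W k)
    simp only [hB_def]
    linarith
  have hz : Tendsto (fun t => Psi f h (x t)) atTop (𝓝 0) := by
    refine squeeze_zero_norm' ?_
      (hBlim.comp ((tendsto_nat_floor_atTop (α := ℝ)).comp (tendsto_id.atTop_div_const hT)))
    filter_upwards [eventually_ge_atTop (0 : ℝ)] with t ht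
    exact hbound t ht
  have hx := (hs.smooth_inv.continuous.tendsto 0).comp hz
  rw [hs.psiInv_zero] at hx
  exact hx.congr fun t => hs.psiInv_psi (x t)

/-- Uniform bounds on the signals of the closed loop. -/
theorem exists_signal_bound (hs : FeedbackLinearizable f g h) (hvL : LipschitzOnBalls v)
    (R U M : ℝ) (hM : 0 < M) :
    ∃ b > 0, ∀ (est : Estimator n) (N : ℕ) (R₀ l C κ T : ℝ) (x : ℝ → Sp n) (u : ℕ → ℝ),
      0 < T → T ≤ 1 → (∀ K, LoopBounds f g h v P est N R₀ R U l C M κ T K x u) →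
      (∀ k, N ≤ k → pairNorm (est T (h ∘ x) u k).1 (est T (h ∘ x) u k).2 ≤ b) ∧
      (∀ k, |inputError f g h v T x u k| ≤ b) ∧ ∀ t : ℝ, 0 ≤ t → ‖x t‖ ≤ b := by
  obtain ⟨ba, hba, Ba⟩ := hs.alphaFn_lipschitz.bounded R
  obtain ⟨bb, hbb, Bb⟩ := hs.betaFn_lipschitz.bounded R
  obtain ⟨bv, hbv, Bv⟩ := hvL.bounded R
  obtain ⟨bx, hbx, Bx⟩ := (LipschitzOnBalls.of_contDiff
    (hs.smooth_inv.of_le (m := 1) (by simp))).bounded (R + 1)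
  set bw := ba + bb * |U| with hbw
  have hbw0 : 0 < bw := by positivity
  -- This bounds the sum of the two components of the estimation error for `T ≤ 1`, which makes the
  -- final bound independent of `T`.
  set be := 2 * (M * (|R| + |U| + |uZero f g h|)) with hbe
  have hbe0 : 0 ≤ be := by positivity
  refine ⟨be + |R| + bw + bv + bx, by positivity, ?_⟩
  intro est N R₀ l C κ T x u hT hT1 hb
  have hw : ∀ k, |zExtra f g h T x u k| ≤ bw := by
    intro k
    obtain ⟨hz, hu⟩ := (hb k).box k le_rfl
    have h2 := Ba _ hz
    have h3 := Bb _ hz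
    rw [Real.norm_eq_abs] at h2 h3
    have h4 : |betaFn f g h (zAt f h T x k) * u k| ≤ bb * |U| := by
      rw [abs_mul]
      have hu' := hu.trans (le_abs_self U)
      gcongr
    refine (abs_add_le _ _).trans ?_
    linarith
  refine ⟨fun k hN => ?_, fun k => ?_, fun t ht => ?_⟩
  · obtain ⟨hz, hu⟩ := (hb k).box k le_rfl
    have he := (hb (k + 1)).estimate k (by omega) hN
    have he' : M * T * (‖zAt f h T x k‖ + |u k - uZero f g h|)
        ≤ M * 1 * (|R| + |U| + |uZero f g h|) := by
      have h0 : ‖zAt f h T x k‖ + |u k - uZero f g h| ≤ |R| + |U| + |uZero f g h| := by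
        have := abs_sub (u k) (uZero f g h)
        linarith [le_abs_self R, le_abs_self U]
      exact mul_le_mul (by gcongr) h0 (by positivity) (by positivity)
    have h1 := (norm_le_pairNorm _ _).trans he
    have h2 := (abs_le_pairNorm _ _).trans he
    have h3 := norm_le_norm_add_norm_sub (zAt f h T x k) (est T (h ∘ x) u k).1
    have h4 := norm_le_norm_add_norm_sub (zExtra f g h T x u k) (est T (h ∘ x) u k).2
    rw [Real.norm_eq_abs, Real.norm_eq_abs, Real.norm_eq_abs] at h4
    refine (pairNorm_le _ _).trans ?_
    have := hw k
    linarith [le_abs_self R]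
  · have h1 := Bv _ ((hb k).box k le_rfl).1
    rw [Real.norm_eq_abs] at h1
    refine (abs_sub _ _).trans ?_
    have := hw k
    linarith [abs_nonneg R]
  · have h1 := ((hb (⌊t / T⌋₊ + 1)).intersample _ (Nat.lt_succ_self _) t
      (mem_sampling_interval hT ht)).2
    have h2 := ((hb ⌊t / T⌋₊).box _ le_rfl).1
    have h3 := norm_le_norm_add_norm_sub' (Psi f h (x t)) (zAt f h T x ⌊t / T⌋₊)
    have h4 := Bx (Psi f h (x t)) (by linarith)
    rw [hs.psiInv_psi] at h4
    linarith [abs_nonneg R]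

end Bounds

end

/-! ### Assembly of the result. -/

theorem lemma1 {n : ℕ} (hn : 1 ≤ n) (f g : Sp n → Sp n) (h : Sp n → ℝ)
    (hsys : FeedbackLinearizable f g h)
    (P : Matrix (Fin n) (Fin n) ℝ) (hP : P.PosDef) (lam : ℝ) (hlam : 0 < lam)
    (v : Sp n → ℝ)
    (hv₁ : LyapunovDecrease f g h v P lam)
    (hv₂ : RobustInput f g h v)
    (N : ℕ) (ustar : ℕ → ℝ)
    (S : Set (Sp n)) (hS : IsCompact S) (hS₀ : (0 : Sp n) ∈ interior S) :
    ∃ γstar > 0,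
      (∀ βbar : ℝ, (∀ z, betaFn f g h z ≤ βbar) → βbar⁻¹ ≤ γstar) ∧
      ∀ γ : ℝ, 0 < γ → γ < γstar →
      ∀ est : Estimator n, est.IsCausal → EstimationError f g h v est γ N ustar →
      ∃ Tstar > 0, ∃ b > 0, ∀ T : ℝ, 0 < T → T ≤ Tstar →
        (∀ x₀ ∈ S, ∃ (x : ℝ → Sp n) (u : ℕ → ℝ),
          ClosedLoop f g h v est γ N ustar T x u ∧ x 0 = x₀) ∧
        (∀ (x : ℝ → Sp n) (u : ℕ → ℝ),
          ClosedLoop f g h v est γ N ustar T x u → x 0 ∈ S →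
            (∀ k, N ≤ k → pairNorm (est T (h ∘ x) u k).1 (est T (h ∘ x) u k).2 ≤ b) ∧
            (∀ k, |inputError f g h v T x u k| ≤ b) ∧
            (∀ t : ℝ, 0 ≤ t → ‖x t‖ ≤ b) ∧
            Tendsto x atTop (𝓝 0)) := by
  have hvL := hv₂.lipschitzOnBalls
  have hv0 := hv₁.map_zero hn hsys hP hlam hvL
  obtain ⟨R₀, R, U, l, hreg⟩ := exists_loopRegion hsys hP hvL hv0 N ustar hS
  obtain ⟨γs, hγs, hupper, hgain⟩ := exists_gain hsys (R := R)
    (by linarith [hreg.nonneg, hreg.radius_le])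
  refine ⟨γs, hγs, hupper, fun γ hγ hγlt est hcausal herr => ?_⟩
  obtain ⟨ρ, hρ₀, hρ, hρgain⟩ := hgain γ hγ hγlt
  obtain ⟨C, hC, M, hM, κ, hκ, T₁, hT₁, hloop⟩ :=
    exists_loopBounds hsys hP hlam hv₁ hvL hv0 hreg hγ hρ₀ hρ hρgain herr
  obtain ⟨T₂, hT₂, hsol⟩ := exists_solution hsys R U
  obtain ⟨b, hb, hbound⟩ := exists_signal_bound (P := P) hsys hvL R U M hM
  refine ⟨min 1 (min T₁ T₂), by positivity, b, hb, fun T hT hTT => ?_⟩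
  simp only [le_min_iff] at hTT
  obtain ⟨hTT₀, hTT₁, hTT₂⟩ := hTT
  obtain ⟨hκT, hloop⟩ := hloop T hT hTT₁
  refine ⟨fun x₀ hx₀ => exists_closedLoop hcausal hT x₀ fun K x u hx hx0 => ?_,
    fun x u hx hx0 => ?_⟩
  -- The bounds apply to every finite trajectory, so at time `KT` the state and input lie where the
  -- existence time is uniform; continuation never stops.
  · obtain ⟨hz, hu⟩ := (hloop K x u hx (hx0 ▸ hx₀)).box K le_rfl
    exact hsol T hT hTT₂ _ _ _ hz hu
  · have hB := fun K => hloop K x u (closedLoop_iff.1 hx K) hx0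
    obtain ⟨h1, h2, h3⟩ := hbound est N R₀ l C κ T x u hT hTT₀ hB
    exact ⟨h1, h2, h3, tendsto_zero_of_loopBounds hsys hP hvL hv0 hC hκ hT hκT hB⟩
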